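/- Let $d\ge 2$ and let $D\subset\mathbb R^d$ be a non-empty, bounded, connected $C^{1,1}$ open set with $C^{1,1}$ characteristics $(R_0,\Lambda)$: $R_0,\Lambda>0$, and for every $z\in\partial D$ there are a $C^{1}$ function $\phi:\mathbb R^{d-1}\to\mathbb R$ with $\phi(0)=0$, $\nabla\phi(0)=0$, $\|\nabla\phi\|_\infty\le\Lambda$ and $|\nabla\phi(y_1)-\nabla\phi(y_2)|\le\Lambda|y_1-y_2|$, and an orthonormal coordinate system $(\widetilde y,y^d)$ with origin at $z$, in which $B(z,R_0)\cap D=B(z,R_0)\cap\{y^d>\phi(\widetilde y)\}$. A number $R>0$ is called a ball radius of $D$ if $D$ satisfies the uniform interior and exterior $R$-ball condition: for every $z\in\partial D$ there are open balls $B_1\subset D$ and $B_2\subset\mathbb R^d\setminus\overline D$ of radius $R$ with $\partial B_1\cap\partial B_2=\{z\}$. Let $X=(X_t)_{t\in[0,1]}=(X^1_t,\dots,X^d_t)_{t\in[0,1]}$ be a process in $\mathbb R^d$ on a probability space $(\Omega,\mathcal F,\mathbb P)$ with càdlàg paths starting at $0$, whose components are zero-mean Gaussian processes with the same law (they need not be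 independent or jointly Gaussian), such that for every $t\in(0,1]$ and every $j$, $\sup_{s\in[0,t]}X^j_s<\infty$ almost surely and $\mathbb P(X^j_t\neq0)>0$. Put $$\mu_t=\mathbb E\Bigl[\sup_{s\in[0,t]}X^1_s\Bigr],\qquad \sigma_t^2=\sup_{s\in[0,t]}\mathbb E\bigl[(X^1_s)^2\bigr],\qquad Q^X_D(t)=\int_D\mathbb P_x(\tau^X_D>t)\,dx,$$ where $\tau_D^X=\inf\{s>0: X_s\notin D\}$ and under $\mathbb P_x$ the process has the law of $x+X$ under $\mathbb P$. Write $|D|$ for the Lebesgue measure of $D$, $|\partial D|$ for the $(d-1)$-dimensional Hausdorff measure of $\partial D$ (normalised to agree with Lebesgue measure on $\mathbb R^{d-1}$), and $D_a=\{x\in D:\operatorname{dist}(x,\partial D)>a\}$. Then: 1. $\min\{R_0/2,\,1/\Lambda\}$ is a ball radius of $D$. 2. For every ball radius $R$ of $D$, every $t\in(0,1]$ and every $a\in(0,R/2]$ with $\mu_t<a/\sqrt d$, $$|D|-Q^X_D(t)\le d^{3/2}2^d|\partial D|\,\mu_t+4d\,|D_a|\exp\Bigl(-\frac{(a/\sqrt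 d-\mu_t)^2}{2\sigma_t^2}\Bigr).$$ 3. Consequently, $$\limsup_{t\downarrow0}\frac{|D|-Q^X_D(t)}{\mu_t}\le d^{3/2}2^d|\partial D|.$$ -/

import Mathlib

open MeasureTheory ProbabilityTheory Filter Topology
open scoped ENNReal NNReal

noncomputable section

namespace GaussianHeat

/-- `d`-dimensional Euclidean space. -/
abbrev E (d : ℕ) : Type := EuclideanSpace ℝ (Fin d)

/-! ### Domains -/

/-- The open set `D` of `ℝ^d` is a `C^{1,1}` open set with `C^{1,1}` characteristics `(R, Λ)`:
near each boundary point `z` there are a `C^{1,1}` function `φ` on `ℝ^{d-1}` and an orthonormal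
coordinate system with origin at `z`, given by a linear isometry `e` of `ℝ^d` onto the Euclidean
product `ℝ^{d-1} × ℝ`, in which `D` is, inside the ball `B(z, R)`, the region above the graph
of `φ`. -/
structure HasC11Characteristics {d : ℕ} (D : Set (E d)) (R Λ : ℝ) : Prop where
  isOpen : IsOpen D
  radius_pos : 0 < R
  const_pos : 0 < Λ
  chart : ∀ z ∈ frontier D,
    ∃ (φ : E (d - 1) → ℝ) (e : E d ≃ₗᵢ[ℝ] WithLp 2 (E (d - 1) × ℝ)),
      ContDiff ℝ 1 φ ∧ φ 0 = 0 ∧ gradient φ 0 = 0 ∧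
      (∀ y, ‖gradient φ y‖ ≤ Λ) ∧
      (∀ y₁ y₂, ‖gradient φ y₁ - gradient φ y₂‖ ≤ Λ * ‖y₁ - y₂‖) ∧
      Metric.ball z R ∩ D =
        Metric.ball z R ∩ {x | φ (e (x - z)).fst < (e (x - z)).snd}

/-- The uniform interior and exterior `R`-ball condition. -/
def UniformBallCondition {d : ℕ} (D : Set (E d)) (R : ℝ) : Prop :=
  0 < R ∧ ∀ z ∈ frontier D, ∃ c₁ c₂ : E d,
    Metric.ball c₁ R ⊆ D ∧ Metric.ball c₂ R ⊆ (closure D)ᶜ ∧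
      frontier (Metric.ball c₁ R) ∩ frontier (Metric.ball c₂ R) = {z}

/-- `D_a`, the set of the points of `D` at Euclidean distance more than `a` from the boundary. -/
def innerPart {d : ℕ} (D : Set (E d)) (a : ℝ) : Set (E d) :=
  {x ∈ D | a < Metric.infDist x (frontier D)}

/-- `|D|`, the `d`-dimensional Lebesgue measure. -/
def vol {d : ℕ} (D : Set (E d)) : ℝ := (volume D).toReal

/-- `|∂D|`, the `(d-1)`-dimensional measure of the boundary: the Hausdorff measure that is
normalised so as to agree with Lebesgue measure on `ℝ^{d-1}`. -/
def perimeter {d : ℕ} (D : Set (E d)) : ℝ :=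
  (Measure.euclideanHausdorffMeasure (d - 1) (frontier D)).toReal

/-! ### Paths and processes, with time set `[0, 1]` -/

/-- A path on `[0, 1]` that is right-continuous and has left limits. -/
def IsCadlag {F : Type*} [TopologicalSpace F] (f : unitInterval → F) : Prop :=
  ∀ t : unitInterval,
    ContinuousWithinAt f (Set.Ici t) t ∧ ∃ l : F, Tendsto f (𝓝[<] t) (𝓝 l)

/-- The first exit time `inf {s > 0 : f s ∉ D}` of a path from `D`; it is `∞` if there is none. -/
def exitTime {F : Type*} (D : Set F) (f : unitInterval → F) : ℝ≥0∞ :=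
  sInf {r : ℝ≥0∞ | ∃ s : unitInterval, 0 < s ∧ f s ∉ D ∧ r = ENNReal.ofReal (s : ℝ)}

variable {Ω : Type*} [MeasurableSpace Ω]

/-- The spectral heat content `Q^X_D(t) = ∫_D ℙ_x(τ_D > t) dx`; under `ℙ_x` the process is
`x + X`, where `X` starts at the origin under `ℙ = ℙ_0`. -/
def spectralHeatContent {d : ℕ} (X : unitInterval → Ω → E d) (P : Measure Ω)
    (D : Set (E d)) (t : unitInterval) : ℝ :=
  (∫⁻ x in D,
    P {ω | ENNReal.ofReal (t : ℝ) < exitTime D (fun s => x + X s ω)}).toReal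

/-- `μ_t = 𝔼[sup_{s ≤ t} Y_s]`, the expected running supremum of a real process. -/
def expectedSup (Y : unitInterval → Ω → ℝ) (P : Measure Ω) (t : unitInterval) : ℝ :=
  ∫ ω, (⨆ s : Set.Iic t, Y s ω) ∂P

/-- `σ_t² = sup_{s ≤ t} 𝔼[Y_s²]`. -/
def supVariance (Y : unitInterval → Ω → ℝ) (P : Measure Ω) (t : unitInterval) : ℝ :=
  ⨆ s : Set.Iic t, ∫ ω, (Y s ω) ^ 2 ∂P

/-- The `j`-th component of a process in `ℝ^d`. -/
def component {d : ℕ} (X : unitInterval → Ω → E d) (j : Fin d) : unitInterval → Ω → ℝ :=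
  fun s ω => X s ω j

/-- A zero-mean Gaussian process in `ℝ`, indexed by `[0, 1]`, that is non-degenerate at every
`t > 0` and almost surely bounded above on every `[0, t]`. -/
structure IsAdmissibleGaussian (Y : unitInterval → Ω → ℝ) (P : Measure Ω) : Prop where
  gaussian : IsGaussianProcess Y P
  mean_zero : ∀ s, ∫ ω, Y s ω ∂P = 0
  nondegenerate : ∀ t, 0 < t → 0 < P {ω | Y t ω ≠ 0}
  bounded : ∀ t, 0 < t → ∀ᵐ ω ∂P, BddAbove ((fun s => Y s ω) '' Set.Iic t)

end GaussianHeat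

end

set_option linter.unusedSectionVars false

namespace GaussianHeat

/-! ### Gaussian concentration in finite dimension -/

/-! The loss |D| - Q is the integral over x in D of the probability of having left D by time t. Let
δ be the distance from x to ∂D. The ball B(x, δ) lies in D, so leaving forces some coordinate of the
displacement to reach ±δ/√d. The components are symmetric and share one law, hence a union bound
over 2d events gives at most 2d · P(M ≥ δ/√d), where M is the running supremum of one component
(`SameLawComponents.one_le`). The joint law of the components plays no role.

On the strip δ ≤ a, Fubini turns the integral of P(M ≥ δ/√d) into the mean volume of a strip of
width min(a, √d M). The tube estimate `volume_infDist_le` bounds this by 2^(d-1) |∂D| √d μ, and 2d ·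
2^(d-1) · √d = d^(3/2) 2^d. On D_a the Borell–TIS inequality
`RegularGaussian.measure_runningSup_ge_le` gives the exponential term. For the limsup, a centred
Gaussian exceeds its standard deviation with a fixed probability p, so σ ≤ μ/p, the exponential is
O(μ²), and μ tends to 0.

Sharp Gaussian concentration comes from infinite divisibility: a centred Gaussian law is the N-fold
convolution of its N^(-1/2)-rescaling. Revealing the N increments one by one gives a martingale
whose differences have conditional variance at most S/N + O(N^(-3/2)), where S bounds the coordinate
variances. Multiplying the conditional exponential moments and letting N → ∞ yields exp(l²S/2). The
maximum itself is unsuitable: at a tie its increment is a maximum of several coordinates, whose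
second moment S need not control. A softmax is differentiable with a probability vector as gradient,
so it is used first, and its temperature is then removed.

The tube estimate uses that two-sided tangent R-balls make the unit normal 1/R-Lipschitz and the
boundary quadratically flat. Locally a tube of width u ≤ R/2 is a √3-Lipschitz image of a slab of
height 2u/3 over a tangent hyperplane, and √3^d · 2/3 ≤ 2^(d-1). -/

lemma exp_le_quadratic_add_cubic (y : ℝ) :
    Real.exp y ≤ 1 + y + y ^ 2 / 2 + |y| ^ 3 * Real.exp |y| := by
  have hE : 1 ≤ Real.exp |y| := Real.one_le_exp (abs_nonneg y)
  rcases le_or_gt |y| 1 with h | h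
  · have h1 := Real.exp_bound h (n := 3) (by norm_num)
    simp only [Finset.sum_range_succ, Finset.sum_range_zero] at h1
    norm_num [Nat.factorial] at h1
    have h2 := (abs_le.1 h1).2
    have h3 : |y| ^ 3 * (2 / 9) ≤ |y| ^ 3 * Real.exp |y| := by gcongr; linarith
    linarith
  · have h1 : Real.exp y ≤ Real.exp |y| := Real.exp_le_exp.2 (le_abs_self y)
    have h2 : 1 * Real.exp |y| ≤ |y| ^ 3 * Real.exp |y| := by
      gcongr
      exact one_le_pow₀ h.le
    -- The quadratic part is nonnegative: 1 + y + y²/2 = ((1 + y)² + 1)/2.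
    nlinarith [sq_nonneg (1 + y)]

/-! ### Exponential moments along convolution powers -/

section Concentration

variable {V : Type*} [NormedAddCommGroup V] [MeasurableSpace V] [BorelSpace V]
  [SecondCountableTopology V]

/-- The norm has exponential moments of all orders. -/
def HasExpMoments (ρ : Measure V) : Prop :=
  ∀ c : ℝ, Integrable (fun h => Real.exp (c * ‖h‖)) ρ

lemma HasExpMoments.integrable_of_le {ρ : Measure V} (hρ : HasExpMoments ρ) {f : V → ℝ}
    (hf : AEStronglyMeasurable f ρ) (A c : ℝ) (h : ∀ v, |f v| ≤ A * Real.exp (c * ‖v‖)) :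
    Integrable f ρ :=
  ((hρ c).const_mul A).mono' hf (ae_of_all _ fun v => by simpa using h v)

lemma HasExpMoments.integrable_pow {ρ : Measure V} (hρ : HasExpMoments ρ) (n : ℕ) :
    Integrable (fun h => ‖h‖ ^ n) ρ := by
  refine hρ.integrable_of_le (by fun_prop) n.factorial 1 fun v => ?_
  rw [abs_of_nonneg (by positivity), one_mul]
  have := Real.pow_div_factorial_le_exp ‖v‖ (norm_nonneg v) n
  rwa [div_le_iff₀' (by positivity)] at this

lemma HasExpMoments.integrable_norm {ρ : Measure V} (hρ : HasExpMoments ρ) :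
    Integrable (fun h => ‖h‖) ρ := by
  simpa using hρ.integrable_pow 1

/-- The cubic remainder in the second order expansion of the exponential moment of a
`1`-Lipschitz function. -/
noncomputable def cubicRemainder (ρ : Measure V) (l : ℝ) : ℝ :=
  ∫ h, (|l| * (‖h‖ + ∫ v, ‖v‖ ∂ρ)) ^ 3 * Real.exp (|l| * (‖h‖ + ∫ v, ‖v‖ ∂ρ)) ∂ρ

lemma HasExpMoments.integrable_cubic {ρ : Measure V} (hρ : HasExpMoments ρ) {a b : ℝ}
    (ha : 0 ≤ a) (hb : 0 ≤ b) :
    Integrable (fun h => (a * (‖h‖ + b)) ^ 3 * Real.exp (a * (‖h‖ + b))) ρ := by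
  refine hρ.integrable_of_le (by fun_prop) (6 * Real.exp (2 * a * b)) (2 * a) fun v => ?_
  rw [abs_of_nonneg (by positivity)]
  have h0 : 0 ≤ a * (‖v‖ + b) := by positivity
  have := Real.pow_div_factorial_le_exp _ h0 3
  rw [div_le_iff₀' (by positivity)] at this
  norm_num [Nat.factorial] at this
  calc _ ≤ 6 * Real.exp (a * (‖v‖ + b)) * Real.exp (a * (‖v‖ + b)) := by gcongr
    _ = 6 * Real.exp (2 * a * b) * Real.exp (2 * a * ‖v‖) := by
      rw [mul_assoc, mul_assoc, ← Real.exp_add, ← Real.exp_add]; ring_nf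

/-- One martingale step. Centring at the mean kills the linear term of the exponential and minimises
the quadratic one, so any centring constant `a` may be used to bound the second moment. Moving from
`a` to the mean costs at most the mean norm, which explains the shape of `cubicRemainder`. -/
lemma integral_exp_centered_le {ρ : Measure V} [IsProbabilityMeasure ρ] (hρ : HasExpMoments ρ)
    {f : V → ℝ} (hf : Continuous f) {a S : ℝ} (hfa : ∀ h, |f h - a| ≤ ‖h‖)
    (hS : ∫ h, (f h - a) ^ 2 ∂ρ ≤ S) (l : ℝ) :
    Integrable (fun h => Real.exp (l * (f h - ∫ v, f v ∂ρ))) ρ ∧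
    ∫ h, Real.exp (l * (f h - ∫ v, f v ∂ρ)) ∂ρ ≤
      Real.exp (l ^ 2 * S / 2 + cubicRemainder ρ l) := by
  set m := ∫ v, ‖v‖ ∂ρ with hm
  have hm0 : 0 ≤ m := integral_nonneg fun _ => norm_nonneg _
  have hg : Integrable (fun h => f h - a) ρ :=
    hρ.integrable_norm.mono' (by fun_prop) (ae_of_all _ fun v => by simpa using hfa v)
  have hfi : Integrable f ρ := by
    simpa using hg.fun_add (integrable_const a)
  have hg2 : Integrable (fun h => (f h - a) ^ 2) ρ :=
    (hρ.integrable_pow 2).mono' (by fun_prop) (ae_of_all _ fun v => by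
      rw [Real.norm_eq_abs, abs_pow]; exact pow_le_pow_left₀ (abs_nonneg _) (hfa v) 2)
  have hmean : ∫ h, (f h - a) ∂ρ = ∫ v, f v ∂ρ - a := by
    rw [integral_sub hfi (integrable_const a)]; simp
  set b := ∫ v, f v ∂ρ with hb
  have hba : |b - a| ≤ m := by
    rw [← hmean]
    exact (abs_integral_le_integral_abs).trans
      (integral_mono hg.abs hρ.integrable_norm hfa)
  have hfb : ∀ h, |l * (f h - b)| ≤ |l| * (‖h‖ + m) := fun h => by
    rw [abs_mul]
    gcongr
    calc |f h - b| = |(f h - a) - (b - a)| := by ring_nf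
      _ ≤ |f h - a| + |b - a| := abs_sub _ _
      _ ≤ ‖h‖ + m := add_le_add (hfa h) hba
  have hcub := hρ.integrable_cubic (abs_nonneg l) hm0
  have hexp : Integrable (fun h => Real.exp (l * (f h - b))) ρ := by
    refine hρ.integrable_of_le (by fun_prop) (Real.exp (|l| * m)) |l| fun v => ?_
    rw [abs_of_pos (Real.exp_pos _), ← Real.exp_add]
    exact Real.exp_le_exp.2 (((le_abs_self _).trans (hfb v)).trans (by linarith))
  refine ⟨hexp, ?_⟩
  have hsq : Integrable (fun h => (f h - b) ^ 2) ρ := by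
    have : (fun h => (f h - b) ^ 2) =
        fun h => (f h - a) ^ 2 - 2 * (b - a) * (f h - a) + (b - a) ^ 2 := by ext; ring
    rw [this]
    exact (hg2.sub (hg.const_mul _)).add (integrable_const _)
  have hvar : ∫ h, (f h - b) ^ 2 ∂ρ ≤ S := by
    have : ∀ h, (f h - b) ^ 2 =
        (f h - a) ^ 2 - 2 * (b - a) * (f h - a) + (b - a) ^ 2 := fun h => by ring
    simp_rw [this]
    have hsub : Integrable (fun h => (f h - a) ^ 2 - 2 * (b - a) * (f h - a)) ρ :=
      hg2.sub (hg.const_mul _)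
    rw [integral_add hsub (integrable_const _), integral_sub hg2 (hg.const_mul _), integral_const_mul, hmean]
    simp only [integral_const, probReal_univ, smul_eq_mul, one_mul]
    nlinarith [sq_nonneg (b - a)]
  have hlin : ∫ h, l * (f h - b) ∂ρ = 0 := by
    rw [integral_const_mul, integral_sub hfi (integrable_const b)]
    simp [hb]
  have hlini : Integrable (fun h => l * (f h - b)) ρ := (hfi.sub (integrable_const b)).const_mul l
  calc ∫ h, Real.exp (l * (f h - b)) ∂ρ
      ≤ ∫ h, (((1 + l * (f h - b)) + l ^ 2 / 2 * (f h - b) ^ 2) +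
          (|l| * (‖h‖ + m)) ^ 3 * Real.exp (|l| * (‖h‖ + m))) ∂ρ := by
        refine integral_mono hexp
          ((((integrable_const _).add hlini).add (hsq.const_mul _)).add hcub) fun h => ?_
        have h1 := exp_le_quadratic_add_cubic (l * (f h - b))
        have h2 : |l * (f h - b)| ^ 3 * Real.exp |l * (f h - b)| ≤
            (|l| * (‖h‖ + m)) ^ 3 * Real.exp (|l| * (‖h‖ + m)) := by
          have := hfb h
          gcongr
        have h3 : (l * (f h - b)) ^ 2 / 2 = l ^ 2 / 2 * (f h - b) ^ 2 := by ring
        simp only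
        linarith
    _ = 1 + l ^ 2 / 2 * ∫ h, (f h - b) ^ 2 ∂ρ + cubicRemainder ρ l := by
        rw [integral_add (((integrable_const _).fun_add hlini).fun_add (hsq.const_mul _)) hcub,
          integral_add ((integrable_const _).fun_add hlini) (hsq.const_mul _),
          integral_add (integrable_const _) hlini, hlin, integral_const_mul]
        simp [cubicRemainder, hm]
    _ ≤ (l ^ 2 * S / 2 + cubicRemainder ρ l) + 1 := by
        have : l ^ 2 / 2 * ∫ h, (f h - b) ^ 2 ∂ρ ≤ l ^ 2 / 2 * S := by gcongr
        linarith
    _ ≤ _ := Real.add_one_le_exp _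

/-- The `1`-Lipschitz functions whose increments along `ρ` have second moment at most `S`. -/
structure IncrementBound (ρ : Measure V) (S : ℝ) (f : V → ℝ) : Prop where
  lipschitz : ∀ x y, |f x - f y| ≤ ‖x - y‖
  sq_le : ∀ x, ∫ h, (f (x + h) - f x) ^ 2 ∂ρ ≤ S

lemma IncrementBound.continuous {ρ : Measure V} {S : ℝ} {f : V → ℝ}
    (hf : IncrementBound ρ S f) : Continuous f :=
  (LipschitzWith.of_dist_le_mul (K := 1) fun x y => by
    simpa [Real.dist_eq, dist_eq_norm] using hf.lipschitz x y).continuous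

lemma IncrementBound.integrable {ρ τ : Measure V} [IsProbabilityMeasure τ]
    (hτ : HasExpMoments τ) {S : ℝ} {f : V → ℝ}
    (hf : IncrementBound ρ S f) (x : V) : Integrable (fun h => f (x + h)) τ := by
  have hc := hf.continuous
  have : Integrable (fun h => f (x + h) - f x) τ :=
    hτ.integrable_norm.mono' (by fun_prop) (ae_of_all _ fun v => by
      simpa using hf.lipschitz (x + v) x)
  simpa using this.fun_add (integrable_const (f x))

/-- Conditional expectations stay in the class, which is what lets the induction over increments
run. The second-moment bound survives by Jensen in the averaged variable followed by Fubini. -/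
lemma IncrementBound.average {ρ : Measure V} [IsProbabilityMeasure ρ] (hρ : HasExpMoments ρ)
    {S : ℝ} {f : V → ℝ} (hf : IncrementBound ρ S f) :
    IncrementBound ρ S (fun x => ∫ y, f (x + y) ∂ρ) where
  lipschitz x y := by
    rw [← integral_sub (hf.integrable hρ x) (hf.integrable hρ y)]
    refine abs_integral_le_integral_abs.trans ?_
    calc ∫ v, |f (x + v) - f (y + v)| ∂ρ ≤ ∫ v, ‖x - y‖ ∂ρ := by
          refine integral_mono ((hf.integrable hρ x).sub (hf.integrable hρ y)).abs
            (integrable_const _) fun v => ?_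
          simpa using hf.lipschitz (x + v) (y + v)
      _ = ‖x - y‖ := by simp
  sq_le x := by
    have hc := hf.continuous
    set G : V × V → ℝ := fun p => f (x + p.1 + p.2) - f (x + p.2) with hG
    have hGle : ∀ p, |G p| ≤ ‖p.1‖ := fun p => by
      simpa [hG] using hf.lipschitz (x + p.1 + p.2) (x + p.2)
    have hGc : Continuous G := by fun_prop
    have hG2 : Integrable (fun p => G p ^ 2) (ρ.prod ρ) :=
      ((hρ.integrable_pow 2).comp_fst ρ).mono' (by fun_prop) (ae_of_all _ fun p => by
        rw [Real.norm_eq_abs, abs_pow]; exact pow_le_pow_left₀ (abs_nonneg _) (hGle p) 2)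
    have hGs : ∀ h, Integrable (fun y => G (h, y)) ρ := fun h =>
      (hf.integrable hρ (x + h)).sub (hf.integrable hρ x)
    have hG2s : ∀ h, Integrable (fun y => G (h, y) ^ 2) ρ := fun h =>
      (integrable_const (‖h‖ ^ 2)).mono' (by fun_prop) (ae_of_all _ fun y => by
        rw [Real.norm_eq_abs, abs_pow]; exact pow_le_pow_left₀ (abs_nonneg _) (hGle (h, y)) 2)
    calc ∫ h, (∫ y, f (x + h + y) ∂ρ - ∫ y, f (x + y) ∂ρ) ^ 2 ∂ρ
        = ∫ h, (∫ y, G (h, y) ∂ρ) ^ 2 ∂ρ := by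
          congr with h
          rw [← integral_sub (hf.integrable hρ _) (hf.integrable hρ x)]
      _ ≤ ∫ h, ∫ y, G (h, y) ^ 2 ∂ρ ∂ρ := by
          refine integral_mono_of_nonneg (ae_of_all _ fun _ => sq_nonneg _)
            hG2.integral_prod_left (ae_of_all _ fun h => ?_)
          exact (even_two.convexOn_pow (𝕜 := ℝ)).map_integral_le (by fun_prop) isClosed_univ
            (by simp) (hGs h) (hG2s h)
      _ = ∫ y, ∫ h, G (h, y) ^ 2 ∂ρ ∂ρ := integral_integral_swap hG2
      _ ≤ ∫ y, S ∂ρ := by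
          refine integral_mono hG2.integral_prod_right (integrable_const _) fun y => ?_
          have := hf.sq_le (x + y)
          simpa [hG, add_right_comm] using this
      _ = S := by simp

/-- The `k`-fold convolution power. -/
noncomputable def convPow (ρ : Measure V) (k : ℕ) : Measure V := (fun τ => τ ∗ ρ)^[k] (Measure.dirac 0)

lemma convPow_zero (ρ : Measure V) : convPow ρ 0 = Measure.dirac 0 := rfl

lemma convPow_succ (ρ : Measure V) (k : ℕ) : convPow ρ (k + 1) = convPow ρ k ∗ ρ := by
  simp [convPow, Function.iterate_succ_apply']

instance (ρ : Measure V) [IsProbabilityMeasure ρ] (k : ℕ) :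
    IsProbabilityMeasure (convPow ρ k) := by
  induction k with
  | zero => rw [convPow_zero]; infer_instance
  | succ k ih => rw [convPow_succ]; infer_instance

lemma HasExpMoments.conv {ρ τ : Measure V} [SFinite ρ] [SFinite τ] (hρ : HasExpMoments ρ)
    (hτ : HasExpMoments τ) : HasExpMoments (τ ∗ ρ) := fun c => by
  have hprod := (hτ |c|).mul_prod (hρ |c|)
  rw [Measure.conv, integrable_map_measure (by fun_prop) (by fun_prop)]
  refine hprod.mono' (by fun_prop) (ae_of_all _ fun p => ?_)
  simp only [Function.comp_apply, Real.norm_eq_abs, Real.abs_exp, ← Real.exp_add]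
  refine Real.exp_le_exp.2 ?_
  calc c * ‖p.1 + p.2‖ ≤ |c| * (‖p.1‖ + ‖p.2‖) :=
        mul_le_mul (le_abs_self c) (norm_add_le _ _) (norm_nonneg _) (abs_nonneg _)
    _ = _ := by ring

lemma HasExpMoments.convPow {ρ : Measure V} [IsProbabilityMeasure ρ] (hρ : HasExpMoments ρ)
    (k : ℕ) : HasExpMoments (convPow ρ k) := by
  induction k with
  | zero => rw [convPow_zero]; exact fun c => integrable_dirac (by simp)
  | succ k ih => rw [convPow_succ]; exact hρ.conv ih

/-- Condition on the first `k` increments. The last one contributes one factor, and what remains is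
the centred exponential moment of the averaged function, which has the same mean and satisfies the
same increment bound. -/
lemma integral_exp_centered_convPow_le {ρ : Measure V} [IsProbabilityMeasure ρ]
    (hρ : HasExpMoments ρ) {S : ℝ} (l : ℝ) (k : ℕ) {f : V → ℝ} (hf : IncrementBound ρ S f)
    (x : V) :
    ∫ h, Real.exp (l * (f (x + h) - ∫ v, f (x + v) ∂(convPow ρ k))) ∂(convPow ρ k) ≤
      Real.exp (l ^ 2 * S / 2 + cubicRemainder ρ l) ^ k := by
  induction k generalizing f x with
  | zero => simp [convPow_zero]
  | succ k ih =>
    set M := Real.exp (l ^ 2 * S / 2 + cubicRemainder ρ l)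
    have hav := hf.average hρ
    have hc := hf.continuous
    have hτ := hρ.convPow k
    have hτ' := hρ.convPow (k + 1)
    set f' : V → ℝ := fun x => ∫ y, f (x + y) ∂ρ with hf'
    have hmean : ∫ v, f (x + v) ∂(convPow ρ (k + 1)) = ∫ v, f' (x + v) ∂(convPow ρ k) := by
      have hi := hf.integrable hτ' x
      rw [convPow_succ] at hi ⊢
      rw [integral_conv hi]
      simp [hf', add_assoc]
    set b := ∫ v, f (x + v) ∂(convPow ρ (k + 1)) with hb
    have hexp : Integrable (fun h => Real.exp (l * (f (x + h) - b))) (convPow ρ (k + 1)) := by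
      refine hτ'.integrable_of_le (by fun_prop) (Real.exp (|l| * |f x - b|)) |l| fun v => ?_
      rw [abs_of_pos (Real.exp_pos _), ← Real.exp_add]
      refine Real.exp_le_exp.2 ((le_abs_self _).trans ?_)
      rw [abs_mul, ← mul_add]
      gcongr
      have h1 := hf.lipschitz (x + v) x
      have h2 := abs_add_le (f x - b) (f (x + v) - f x)
      have h3 : (f x - b) + (f (x + v) - f x) = f (x + v) - b := by ring
      rw [h3] at h2
      simp only [add_sub_cancel_left] at h1
      linarith
    have hexp' : Integrable (fun h => Real.exp (l * (f' (x + h) - b))) (convPow ρ k) := by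
      have hc' := hav.continuous
      refine hτ.integrable_of_le (by fun_prop) (Real.exp (|l| * |f' x - b|)) |l| fun v => ?_
      rw [abs_of_pos (Real.exp_pos _), ← Real.exp_add]
      refine Real.exp_le_exp.2 ((le_abs_self _).trans ?_)
      rw [abs_mul, ← mul_add]
      gcongr
      have h1 := hav.lipschitz (x + v) x
      have h2 := abs_add_le (f' x - b) (f' (x + v) - f' x)
      have h3 : (f' x - b) + (f' (x + v) - f' x) = f' (x + v) - b := by ring
      rw [h3] at h2
      simp only [add_sub_cancel_left] at h1
      linarith
    have hstep : ∀ h, ∫ y, Real.exp (l * (f (x + (h + y)) - b)) ∂ρ ≤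
        M * Real.exp (l * (f' (x + h) - b)) := fun h => by
      have := (integral_exp_centered_le hρ (f := fun y => f (x + h + y)) (by fun_prop)
        (a := f (x + h)) (fun y => by simpa using hf.lipschitz (x + h + y) (x + h))
        (hf.sq_le (x + h)) l).2
      calc ∫ y, Real.exp (l * (f (x + (h + y)) - b)) ∂ρ
          = ∫ y, Real.exp (l * (f (x + h + y) - ∫ v, f (x + h + v) ∂ρ)) *
              Real.exp (l * (f' (x + h) - b)) ∂ρ := by
            congr with y
            rw [← Real.exp_add, add_assoc x h y, hf']
            ring_nf
        _ ≤ _ := by rw [integral_mul_const]; gcongr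
    calc ∫ h, Real.exp (l * (f (x + h) - b)) ∂(convPow ρ (k + 1))
        = ∫ h, ∫ y, Real.exp (l * (f (x + (h + y)) - b)) ∂ρ ∂(convPow ρ k) := by
          have hi := hexp
          rw [convPow_succ] at hi ⊢
          rw [integral_conv hi]
      _ ≤ ∫ h, M * Real.exp (l * (f' (x + h) - b)) ∂(convPow ρ k) :=
          integral_mono_of_nonneg
            (ae_of_all _ fun h => integral_nonneg fun y => (Real.exp_pos _).le)
            (hexp'.const_mul M) (ae_of_all _ hstep)
      _ = M * ∫ h, Real.exp (l * (f' (x + h) - b)) ∂(convPow ρ k) := integral_const_mul _ _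
      _ ≤ M * M ^ k := by
          gcongr
          have := ih hav x
          rwa [← hmean] at this
      _ = M ^ (k + 1) := by ring

end Concentration

/-! ### Softmax and its second-order behaviour -/

section Softmax

variable {ι : Type*} [Fintype ι] [Nonempty ι]

/-- The smooth approximation `β⁻¹ log ∑ exp (β xᵢ)` of the maximum of the coordinates. -/
noncomputable def softmax (β : ℝ) (x : ι → ℝ) : ℝ := β⁻¹ * Real.log (∑ i, Real.exp (β * x i))

/-- The gradient of `softmax`. -/
noncomputable def softmaxWeight (β : ℝ) (x : ι → ℝ) (i : ι) : ℝ :=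
  Real.exp (β * x i) / ∑ j, Real.exp (β * x j)

lemma sum_exp_pos (β : ℝ) (x : ι → ℝ) : 0 < ∑ i, Real.exp (β * x i) :=
  Finset.sum_pos (fun _ _ => Real.exp_pos _) Finset.univ_nonempty

lemma softmaxWeight_nonneg (β : ℝ) (x : ι → ℝ) (i : ι) : 0 ≤ softmaxWeight β x i :=
  div_nonneg (Real.exp_pos _).le (sum_exp_pos β x).le

lemma sum_softmaxWeight (β : ℝ) (x : ι → ℝ) : ∑ i, softmaxWeight β x i = 1 := by
  simp only [softmaxWeight]
  rw [← Finset.sum_div, div_self (sum_exp_pos β x).ne']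

lemma softmax_add_sub {β : ℝ} (x h : ι → ℝ) :
    softmax β (x + h) - softmax β x =
      β⁻¹ * Real.log (∑ i, softmaxWeight β x i * Real.exp (β * h i)) := by
  have h1 : ∑ i, softmaxWeight β x i * Real.exp (β * h i) =
      (∑ i, Real.exp (β * (x + h) i)) / ∑ i, Real.exp (β * x i) := by
    rw [Finset.sum_div]
    refine Finset.sum_congr rfl fun i _ => ?_
    rw [softmaxWeight, Pi.add_apply, mul_add, Real.exp_add]
    ring
  rw [h1, Real.log_div (sum_exp_pos β _).ne' (sum_exp_pos β x).ne', softmax, softmax]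
  ring

lemma softmax_add_le {β : ℝ} (hβ : 0 < β) (x h : ι → ℝ) :
    softmax β (x + h) - softmax β x ≤ ‖h‖ := by
  rw [softmax_add_sub, inv_mul_le_iff₀ hβ, Real.log_le_iff_le_exp]
  · calc ∑ i, softmaxWeight β x i * Real.exp (β * h i)
        ≤ ∑ i, softmaxWeight β x i * Real.exp (β * ‖h‖) := by
          refine Finset.sum_le_sum fun i _ => mul_le_mul_of_nonneg_left ?_
            (softmaxWeight_nonneg β x i)
          gcongr
          exact (le_abs_self _).trans (norm_le_pi_norm h i)
      _ = _ := by rw [← Finset.sum_mul, sum_softmaxWeight, one_mul]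
  · refine Finset.sum_pos (fun i _ => mul_pos ?_ (Real.exp_pos _)) Finset.univ_nonempty
    exact div_pos (Real.exp_pos _) (sum_exp_pos β x)

lemma abs_softmax_sub_le {β : ℝ} (hβ : 0 < β) (x y : ι → ℝ) :
    |softmax β x - softmax β y| ≤ ‖x - y‖ := by
  rw [abs_le]
  have h1 := softmax_add_le hβ y (x - y)
  have h2 := softmax_add_le hβ x (y - x)
  rw [add_sub_cancel] at h1 h2
  rw [norm_sub_rev] at h2
  constructor <;> linarith

lemma abs_sum_softmaxWeight_le (β : ℝ) (x h : ι → ℝ) :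
    |∑ i, softmaxWeight β x i * h i| ≤ ‖h‖ := by
  calc |∑ i, softmaxWeight β x i * h i| ≤ ∑ i, |softmaxWeight β x i * h i| :=
        Finset.abs_sum_le_sum_abs _ _
    _ ≤ ∑ i, softmaxWeight β x i * ‖h‖ := by
        refine Finset.sum_le_sum fun i _ => ?_
        rw [abs_mul, abs_of_nonneg (softmaxWeight_nonneg β x i)]
        exact mul_le_mul_of_nonneg_left (norm_le_pi_norm h i) (softmaxWeight_nonneg β x i)
    _ = ‖h‖ := by rw [← Finset.sum_mul, sum_softmaxWeight, one_mul]

/-- For β‖h‖ ≤ 1 the lower bound is Jensen for exp, and the upper bound combines log v ≤ v - 1 with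
exp u ≤ 1 + u + u². For larger increments the Lipschitz bounds 2‖h‖ ≤ 2β‖h‖² suffice. -/
lemma abs_softmax_add_sub_sub_le {β : ℝ} (hβ : 0 < β) (x h : ι → ℝ) :
    |softmax β (x + h) - softmax β x - ∑ i, softmaxWeight β x i * h i| ≤ 2 * β * ‖h‖ ^ 2 := by
  have hL := abs_sum_softmaxWeight_le β x h
  rcases le_or_gt (β * ‖h‖) 1 with hs | hs
  · have hw := softmaxWeight_nonneg β x
    have hlow : ∑ i, softmaxWeight β x i * h i ≤ softmax β (x + h) - softmax β x := by
      rw [softmax_add_sub, le_inv_mul_iff₀ hβ, Real.le_log_iff_exp_le]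
      · have := convexOn_exp.map_sum_le (t := Finset.univ) (w := softmaxWeight β x)
          (p := fun i => β * h i) (fun i _ => hw i) (sum_softmaxWeight β x) (by simp)
        simp only [smul_eq_mul] at this
        refine le_trans (le_of_eq ?_) this
        rw [Finset.mul_sum]
        congr 1
        exact Finset.sum_congr rfl fun i _ => by ring
      · refine Finset.sum_pos (fun i _ => mul_pos ?_ (Real.exp_pos _)) Finset.univ_nonempty
        exact div_pos (Real.exp_pos _) (sum_exp_pos β x)
    have hup : softmax β (x + h) - softmax β x ≤
        ∑ i, softmaxWeight β x i * h i + β * ‖h‖ ^ 2 := by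
      rw [softmax_add_sub, inv_mul_le_iff₀ hβ]
      have hpos : 0 < ∑ i, softmaxWeight β x i * Real.exp (β * h i) := by
        refine Finset.sum_pos (fun i _ => mul_pos ?_ (Real.exp_pos _)) Finset.univ_nonempty
        exact div_pos (Real.exp_pos _) (sum_exp_pos β x)
      refine (Real.log_le_sub_one_of_pos hpos).trans ?_
      have : ∑ i, softmaxWeight β x i * Real.exp (β * h i) ≤
          ∑ i, softmaxWeight β x i * (1 + β * h i + β ^ 2 * ‖h‖ ^ 2) := by
        refine Finset.sum_le_sum fun i _ => mul_le_mul_of_nonneg_left ?_ (hw i)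
        have hi : |β * h i| ≤ β * ‖h‖ := by
          rw [abs_mul, abs_of_pos hβ]
          exact mul_le_mul_of_nonneg_left (norm_le_pi_norm h i) hβ.le
        have h1 := (abs_le.1 (Real.abs_exp_sub_one_sub_id_le (hi.trans hs))).2
        have h2 : (β * h i) ^ 2 ≤ (β * ‖h‖) ^ 2 := sq_le_sq' (abs_le.1 hi).1 (abs_le.1 hi).2
        nlinarith
      have h2 : ∑ i, softmaxWeight β x i * (1 + β * h i + β ^ 2 * ‖h‖ ^ 2) =
          1 + β * ∑ i, softmaxWeight β x i * h i + β ^ 2 * ‖h‖ ^ 2 := by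
        simp only [mul_add, Finset.sum_add_distrib, ← Finset.sum_mul, sum_softmaxWeight]
        rw [Finset.mul_sum]
        simp only [mul_left_comm, one_mul, mul_one]
      nlinarith
    rw [abs_le]
    have : 0 ≤ β * ‖h‖ ^ 2 := by positivity
    constructor <;> nlinarith
  · have h1 := abs_softmax_sub_le hβ (x + h) x
    rw [add_sub_cancel_left] at h1
    calc _ ≤ |softmax β (x + h) - softmax β x| + |∑ i, softmaxWeight β x i * h i| := abs_sub _ _
      _ ≤ 2 * ‖h‖ := by linarith
      _ ≤ 2 * β * ‖h‖ ^ 2 := by nlinarith [norm_nonneg h]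

/-- By Jensen the squared linear part is at most the weighted mean of the squares. A weighted mean
of coordinate variances is at most the largest of them, so the dimension does not enter the leading
term. -/
lemma sq_softmax_add_sub_le {β : ℝ} (hβ : 0 < β) (x h : ι → ℝ) :
    (softmax β (x + h) - softmax β x) ^ 2 ≤
      ∑ i, softmaxWeight β x i * h i ^ 2 + 4 * β * ‖h‖ ^ 3 := by
  set A := softmax β (x + h) - softmax β x
  set w := ∑ i, softmaxWeight β x i * h i
  have h1 : |A| ≤ ‖h‖ := by simpa [A] using abs_softmax_sub_le hβ (x + h) x
  have h2 : |w| ≤ ‖h‖ := abs_sum_softmaxWeight_le β x h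
  have h3 : |A - w| ≤ 2 * β * ‖h‖ ^ 2 := abs_softmax_add_sub_sub_le hβ x h
  have h4 : w ^ 2 ≤ ∑ i, softmaxWeight β x i * h i ^ 2 := by
    simpa using (even_two.convexOn_pow (𝕜 := ℝ)).map_sum_le (t := Finset.univ)
      (w := softmaxWeight β x) (p := h) (fun i _ => softmaxWeight_nonneg β x i)
      (sum_softmaxWeight β x) (by simp)
  have h5 : A ^ 2 - w ^ 2 ≤ 4 * β * ‖h‖ ^ 3 := by
    calc A ^ 2 - w ^ 2 = (A - w) * (A + w) := by ring
      _ ≤ |A - w| * |A + w| := by rw [← abs_mul]; exact le_abs_self _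
      _ ≤ (2 * β * ‖h‖ ^ 2) * (2 * ‖h‖) := by
          gcongr
          exact (abs_add_le _ _).trans (by linarith)
      _ = _ := by ring
  linarith

lemma iSup_le_softmax {β : ℝ} (hβ : 0 < β) (x : ι → ℝ) : ⨆ i, x i ≤ softmax β x := by
  refine ciSup_le fun i => ?_
  rw [softmax, le_inv_mul_iff₀ hβ, Real.le_log_iff_exp_le (sum_exp_pos β x)]
  exact Finset.single_le_sum (f := fun i => Real.exp (β * x i))
    (fun _ _ => (Real.exp_pos _).le) (Finset.mem_univ i)

lemma softmax_le_iSup_add {β : ℝ} (hβ : 0 < β) (x : ι → ℝ) :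
    softmax β x ≤ (⨆ i, x i) + β⁻¹ * Real.log (Fintype.card ι) := by
  have hb : BddAbove (Set.range x) := (Set.finite_range x).bddAbove
  have hn : (0 : ℝ) < Fintype.card ι := by exact_mod_cast Fintype.card_pos
  rw [softmax, ← sub_le_iff_le_add, ← mul_sub, inv_mul_le_iff₀ hβ, sub_le_iff_le_add,
    Real.log_le_iff_le_exp (sum_exp_pos β x), Real.exp_add, Real.exp_log hn]
  calc ∑ i, Real.exp (β * x i) ≤ ∑ _i : ι, Real.exp (β * ⨆ i, x i) := by
        refine Finset.sum_le_sum fun i _ => Real.exp_le_exp.2 ?_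
        exact mul_le_mul_of_nonneg_left (le_ciSup hb i) hβ.le
    _ = _ := by simp [mul_comm]

lemma incrementBound_softmax {β : ℝ} (hβ : 0 < β) {ρ : Measure (ι → ℝ)}
    [IsProbabilityMeasure ρ] (hρ : HasExpMoments ρ) {S : ℝ}
    (hS : ∀ i, ∫ h, h i ^ 2 ∂ρ ≤ S) :
    IncrementBound ρ (S + 4 * β * ∫ h, ‖h‖ ^ 3 ∂ρ) (softmax β) where
  lipschitz := abs_softmax_sub_le hβ
  sq_le x := by
    have hi : ∀ i, Integrable (fun h : ι → ℝ => softmaxWeight β x i * h i ^ 2) ρ := fun i =>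
      ((hρ.integrable_pow 2).mono' ((by fun_prop : Continuous fun h : ι → ℝ => h i ^ 2).aestronglyMeasurable)
        (ae_of_all _ fun h => by
        rw [Real.norm_eq_abs, abs_pow]
        exact pow_le_pow_left₀ (abs_nonneg _) (norm_le_pi_norm h i) 2)).const_mul _
    calc ∫ h, (softmax β (x + h) - softmax β x) ^ 2 ∂ρ
        ≤ ∫ h, (∑ i, softmaxWeight β x i * h i ^ 2 + 4 * β * ‖h‖ ^ 3) ∂ρ :=
          integral_mono_of_nonneg (ae_of_all _ fun _ => sq_nonneg _)
            ((integrable_finsetSum _ fun i _ => hi i).add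
              ((hρ.integrable_pow 3).const_mul _))
            (ae_of_all _ (sq_softmax_add_sub_le hβ x))
      _ = ∑ i, softmaxWeight β x i * ∫ h, h i ^ 2 ∂ρ + 4 * β * ∫ h, ‖h‖ ^ 3 ∂ρ := by
          rw [integral_add (integrable_finsetSum _ fun i _ => hi i)
            ((hρ.integrable_pow 3).const_mul _), integral_finsetSum _ fun i _ => hi i,
            integral_const_mul]
          simp only [integral_const_mul]
      _ ≤ ∑ i, softmaxWeight β x i * S + 4 * β * ∫ h, ‖h‖ ^ 3 ∂ρ := by
          gcongr with i _
          · exact softmaxWeight_nonneg β x i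
          · exact hS i
      _ = _ := by rw [← Finset.sum_mul, sum_softmaxWeight, one_mul]

end Softmax

/-! ### Infinite divisibility of centred Gaussian laws -/

section GaussianMeasure

variable {V : Type*} [NormedAddCommGroup V] [NormedSpace ℝ V] [MeasurableSpace V] [BorelSpace V]
  [SecondCountableTopology V] [CompleteSpace V]

/-- Fernique's theorem gives integrability of exp(C‖v‖²); completing the square absorbs the linear
exponent. -/
lemma hasExpMoments_of_isGaussian (ν : Measure V) [IsGaussian ν] : HasExpMoments ν := fun c => by
  obtain ⟨C, hC, hint⟩ := IsGaussian.exists_integrable_exp_sq ν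
  refine (hint.const_mul (Real.exp (c ^ 2 / (4 * C)))).mono' (by fun_prop)
    (ae_of_all _ fun v => ?_)
  rw [Real.norm_eq_abs, Real.abs_exp, ← Real.exp_add]
  refine Real.exp_le_exp.2 ?_
  have : c ^ 2 / (4 * C) + C * ‖v‖ ^ 2 - c * ‖v‖ = C * (‖v‖ - c / (2 * C)) ^ 2 := by
    field_simp; ring
  nlinarith [mul_nonneg hC.le (sq_nonneg (‖v‖ - c / (2 * C)))]

/-- The law of `X / √N`, where `X` has law `ν`. -/
noncomputable def scaleDown (ν : Measure V) (N : ℕ) : Measure V :=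
  ν.map (fun x => (√(N : ℝ))⁻¹ • x)

lemma isGaussian_scaleDown (ν : Measure V) [IsGaussian ν] (N : ℕ) :
    IsGaussian (scaleDown ν N) :=
  inferInstanceAs (IsGaussian (ν.map ((√(N : ℝ))⁻¹ • ContinuousLinearMap.id ℝ V)))

lemma charFunDual_convPow (ρ : Measure V) [IsProbabilityMeasure ρ] (k : ℕ)
    (T : StrongDual ℝ V) : charFunDual (convPow ρ k) T = charFunDual ρ T ^ k := by
  induction k with
  | zero => rw [convPow_zero]; simp
  | succ k ih => rw [convPow_succ, charFunDual_conv, ih, pow_succ]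

lemma convPow_scaleDown (ν : Measure V) [IsGaussian ν] (hν : ∫ x, x ∂ν = 0) {N : ℕ}
    (hN : 0 < N) : convPow (scaleDown ν N) N = ν := by
  have := isGaussian_scaleDown ν N
  refine Measure.ext_of_charFunDual ?_
  ext T
  have hmap : charFunDual (scaleDown ν N) T = charFunDual ν ((√(N : ℝ))⁻¹ • T) := by
    have h : T.comp ((√(N : ℝ))⁻¹ • ContinuousLinearMap.id ℝ V) = (√(N : ℝ))⁻¹ • T := by
      ext; simp
    rw [← h, ← charFunDual_map]
    rfl
  rw [charFunDual_convPow, hmap, IsGaussian.charFunDual_eq_of_integral_eq_zero hν,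
    IsGaussian.charFunDual_eq_of_integral_eq_zero hν, ← Complex.exp_nat_mul]
  have hv : Var[(((√(N : ℝ))⁻¹ • T : StrongDual ℝ V) : V → ℝ); ν] = (N : ℝ)⁻¹ * Var[T; ν] := by
    rw [FunLike.coe_smul, variance_smul, inv_pow, Real.sq_sqrt (by positivity)]
  rw [hv]
  congr 1
  have : (N : ℂ) ≠ 0 := by exact_mod_cast hN.ne'
  push_cast
  field_simp

lemma integral_scaleDown (ν : Measure V) (N : ℕ) {f : V → ℝ} (hf : Continuous f) :
    ∫ x, f x ∂(scaleDown ν N) = ∫ x, f ((√(N : ℝ))⁻¹ • x) ∂ν :=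
  integral_map (by fun_prop) (by fun_prop)

/-- The rate N^(-3/2) is what makes the total error of N steps vanish. Scaling factors out of the
cube exactly; in the exponential it is at most 1 and is dropped. -/
lemma cubicRemainder_scaleDown_le (ν : Measure V) [IsGaussian ν] {N : ℕ} (hN : 0 < N) (l : ℝ) :
    cubicRemainder (scaleDown ν N) l ≤ (√(N : ℝ))⁻¹ ^ 3 * cubicRemainder ν l := by
  have hN' : (1 : ℝ) ≤ N := by exact_mod_cast hN
  set c := (√(N : ℝ))⁻¹ with hc
  have hc0 : 0 ≤ c := by positivity
  have hc1 : c ≤ 1 := inv_le_one_of_one_le₀ (Real.one_le_sqrt.2 hN')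
  have hn : ∀ v : V, ‖c • v‖ = c * ‖v‖ := fun v => by rw [norm_smul, Real.norm_of_nonneg hc0]
  set m := ∫ v, ‖v‖ ∂ν with hm
  have hm0 : 0 ≤ m := integral_nonneg fun _ => norm_nonneg _
  have hmN : ∫ v, ‖v‖ ∂(scaleDown ν N) = c * m := by
    rw [integral_scaleDown ν N (by fun_prop), ← integral_const_mul]
    simp only [← hc, hn]
  have hint := (hasExpMoments_of_isGaussian ν).integrable_cubic (abs_nonneg l) hm0
  have key : ∀ h : V, (|l| * (‖c • h‖ + c * m)) ^ 3 * Real.exp (|l| * (‖c • h‖ + c * m)) ≤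
      c ^ 3 * ((|l| * (‖h‖ + m)) ^ 3 * Real.exp (|l| * (‖h‖ + m))) := fun h => by
    have h0 : 0 ≤ |l| * (‖h‖ + m) := by positivity
    have h1 : |l| * (‖c • h‖ + c * m) = c * (|l| * (‖h‖ + m)) := by rw [hn]; ring
    rw [h1, mul_pow, mul_assoc]
    have h2 : c * (|l| * (‖h‖ + m)) ≤ |l| * (‖h‖ + m) := mul_le_of_le_one_left h0 hc1
    exact mul_le_mul_of_nonneg_left (mul_le_mul_of_nonneg_left (Real.exp_le_exp.2 h2)
      (by positivity)) (by positivity)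
  calc cubicRemainder (scaleDown ν N) l
      = ∫ h, (|l| * (‖c • h‖ + c * m)) ^ 3 * Real.exp (|l| * (‖c • h‖ + c * m)) ∂ν := by
        rw [cubicRemainder, hmN, integral_scaleDown ν N (by fun_prop)]
    _ ≤ ∫ h, c ^ 3 * ((|l| * (‖h‖ + m)) ^ 3 * Real.exp (|l| * (‖h‖ + m))) ∂ν :=
        integral_mono_of_nonneg (ae_of_all _ fun h => by positivity) (hint.const_mul _)
          (ae_of_all _ key)
    _ = _ := integral_const_mul _ _

end GaussianMeasure

/-! ### Sub-Gaussian bound for the maximum of a Gaussian vector -/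

section FiniteMaximum

variable {ι : Type*} [Fintype ι] [Nonempty ι]

lemma continuous_softmax {β : ℝ} (hβ : 0 < β) : Continuous (softmax β : (ι → ℝ) → ℝ) :=
  (LipschitzWith.of_dist_le_mul (K := 1) fun x y => by
    simpa [Real.dist_eq, dist_eq_norm] using abs_softmax_sub_le hβ x y).continuous

lemma integral_exp_softmax_le (ν : Measure (ι → ℝ)) [IsGaussian ν] (hν : ∫ x, x ∂ν = 0)
    {S : ℝ} (hS : ∀ i, ∫ x, x i ^ 2 ∂ν ≤ S) {β : ℝ} (hβ : 0 < β) (l : ℝ) :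
    ∫ x, Real.exp (l * (softmax β x - ∫ y, softmax β y ∂ν)) ∂ν ≤ Real.exp (l ^ 2 * S / 2) := by
  set m := ∫ x, ‖x‖ ^ 3 ∂ν
  -- Both errors, from the curvature of the softmax and from the cubic remainder, scale like
  -- N^(-3/2) per step, hence like N^(-1/2) · `K` in total.
  set K := 2 * β * l ^ 2 * m + cubicRemainder ν l with hK
  have hbound : ∀ N : ℕ, ∫ x, Real.exp (l * (softmax β x - ∫ y, softmax β y ∂ν)) ∂ν ≤
      Real.exp (l ^ 2 * S / 2 + (√((N + 1 : ℕ) : ℝ))⁻¹ * K) := fun n => by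
    set N := n + 1
    have hN : 0 < N := n.succ_pos
    have hN0 : (0 : ℝ) < N := by exact_mod_cast hN
    have hg := isGaussian_scaleDown ν N
    have hexp := hasExpMoments_of_isGaussian (scaleDown ν N)
    set c := (√(N : ℝ))⁻¹ with hc
    have hc2 : c ^ 2 = (N : ℝ)⁻¹ := by rw [hc, inv_pow, Real.sq_sqrt hN0.le]
    have hc0 : 0 ≤ c := by positivity
    have hm3 : ∫ x, ‖x‖ ^ 3 ∂(scaleDown ν N) = c ^ 3 * m := by
      rw [integral_scaleDown ν N (by fun_prop), ← integral_const_mul]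
      simp only [← hc, norm_smul, Real.norm_of_nonneg hc0, mul_pow]
    have hS' : ∀ i, ∫ x, x i ^ 2 ∂(scaleDown ν N) ≤ (N : ℝ)⁻¹ * S := fun i => by
      rw [integral_scaleDown ν N (by fun_prop)]
      simp only [Pi.smul_apply, smul_eq_mul, mul_pow]
      rw [integral_const_mul, ← hc, hc2]
      exact mul_le_mul_of_nonneg_left (hS i) (by positivity)
    have h := integral_exp_centered_convPow_le hexp l N (incrementBound_softmax hβ hexp hS') 0
    rw [convPow_scaleDown ν hν hN] at h
    simp only [zero_add] at h
    refine h.trans ?_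
    rw [← Real.exp_nat_mul, hm3]
    refine Real.exp_le_exp.2 ?_
    have hR := mul_le_mul_of_nonneg_left (cubicRemainder_scaleDown_le ν hN l) hN0.le
    rw [← hc] at hR
    have hNc : (N : ℝ) * c ^ 3 = c := by
      rw [pow_succ, hc2, ← mul_assoc, mul_inv_cancel₀ hN0.ne', one_mul]
    have hNN : (N : ℝ) * (N : ℝ)⁻¹ = 1 := mul_inv_cancel₀ hN0.ne'
    calc (N : ℝ) * (l ^ 2 * ((N : ℝ)⁻¹ * S + 4 * β * (c ^ 3 * m)) / 2 +
          cubicRemainder (scaleDown ν N) l)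
        = ((N : ℝ) * (N : ℝ)⁻¹) * (l ^ 2 * S / 2) + ((N : ℝ) * c ^ 3) * (2 * β * l ^ 2 * m)
          + N * cubicRemainder (scaleDown ν N) l := by ring
      _ ≤ ((N : ℝ) * (N : ℝ)⁻¹) * (l ^ 2 * S / 2) + ((N : ℝ) * c ^ 3) * (2 * β * l ^ 2 * m)
          + N * (c ^ 3 * cubicRemainder ν l) := by gcongr
      _ = _ := by rw [← mul_assoc (N : ℝ) (c ^ 3) (cubicRemainder ν l), hNc, hNN, hK]; ring
  refine ge_of_tendsto' (x := atTop) ?_ hbound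
  have hlim : Tendsto (fun n : ℕ => (√((n + 1 : ℕ) : ℝ))⁻¹) atTop (𝓝 0) :=
    (Real.tendsto_sqrt_atTop.comp
      (tendsto_natCast_atTop_atTop.comp (tendsto_add_atTop_nat 1))).inv_tendsto_atTop
  have := (hlim.mul_const K).const_add (l ^ 2 * S / 2)
  rw [zero_mul, add_zero] at this
  exact (Real.continuous_exp.tendsto _).comp this

lemma abs_iSup_le_norm (x : ι → ℝ) : |⨆ i, x i| ≤ ‖x‖ := by
  have hb : BddAbove (Set.range x) := (Set.finite_range x).bddAbove
  obtain ⟨i⟩ := ‹Nonempty ι›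
  rw [abs_le]
  constructor
  · exact (neg_le_of_abs_le (norm_le_pi_norm x i)).trans (le_ciSup hb i)
  · exact ciSup_le fun j => (le_abs_self _).trans (norm_le_pi_norm x j)

lemma measurable_iSup_eval : Measurable fun x : ι → ℝ => ⨆ i, x i :=
  Measurable.iSup fun i => measurable_pi_apply i

lemma integrable_iSup_eval (ν : Measure (ι → ℝ)) [IsGaussian ν] :
    Integrable (fun x : ι → ℝ => ⨆ i, x i) ν :=
  (hasExpMoments_of_isGaussian ν).integrable_norm.mono' measurable_iSup_eval.aestronglyMeasurable
    (ae_of_all _ abs_iSup_le_norm)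

lemma integrable_exp_iSup_eval (ν : Measure (ι → ℝ)) [IsGaussian ν] (l b : ℝ) :
    Integrable (fun x : ι → ℝ => Real.exp (l * ((⨆ i, x i) - b))) ν := by
  refine (hasExpMoments_of_isGaussian ν).integrable_of_le
    (((measurable_iSup_eval.sub_const b).const_mul l).exp.aestronglyMeasurable)
    (Real.exp (|l| * |b|)) |l| fun x => ?_
  rw [abs_of_pos (Real.exp_pos _), ← Real.exp_add, ← mul_add]
  refine Real.exp_le_exp.2 ((le_abs_self _).trans ?_)
  rw [abs_mul]
  gcongr
  exact (abs_sub _ _).trans (by linarith [abs_iSup_le_norm x])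

/-- The sharp sub-Gaussian bound for the maximum of a centered Gaussian vector. -/
lemma integral_exp_iSup_le (ν : Measure (ι → ℝ)) [IsGaussian ν] (hν : ∫ x, x ∂ν = 0)
    {S : ℝ} (hS : ∀ i, ∫ x, x i ^ 2 ∂ν ≤ S) (l : ℝ) :
    ∫ x : ι → ℝ, Real.exp (l * ((⨆ i, x i) - ∫ y : ι → ℝ, ⨆ i, y i ∂ν)) ∂ν ≤
      Real.exp (l ^ 2 * S / 2) := by
  set b := ∫ y : ι → ℝ, ⨆ i, y i ∂ν with hb
  set L := Real.log (Fintype.card ι)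
  have hexp := hasExpMoments_of_isGaussian ν
  have hL : 0 ≤ L := Real.log_nonneg (by exact_mod_cast Fintype.card_pos)
  have hmax := integrable_iSup_eval ν (ι := ι)
  have hbound : ∀ n : ℕ, ∫ x : ι → ℝ, Real.exp (l * ((⨆ i, x i) - b)) ∂ν ≤
      Real.exp (|l| * (((n + 1 : ℕ) : ℝ)⁻¹ * L)) * Real.exp (l ^ 2 * S / 2) := fun n => by
    set β : ℝ := ((n + 1 : ℕ) : ℝ)
    have hβ : 0 < β := by positivity
    have hcont := continuous_softmax (ι := ι) hβ
    have hFi : Integrable (softmax β : (ι → ℝ) → ℝ) ν := by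
      have := (incrementBound_softmax hβ hexp hS).integrable hexp 0
      simpa using this
    set B := ∫ y : ι → ℝ, softmax β y ∂ν
    have hBb : b ≤ B := integral_mono hmax hFi (iSup_le_softmax hβ)
    have hBb' : B ≤ b + β⁻¹ * L := by
      calc B ≤ ∫ y : ι → ℝ, ((⨆ i, y i) + β⁻¹ * L) ∂ν :=
            integral_mono hFi (hmax.add (integrable_const _)) (softmax_le_iSup_add hβ)
        _ = b + β⁻¹ * L := by rw [integral_add hmax (integrable_const _)]; simp [hb]
    have hFexp : Integrable (fun x : ι → ℝ => Real.exp (l * (softmax β x - B))) ν :=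
      (integral_exp_centered_le hexp hcont (a := softmax β 0)
        (fun h => by simpa using abs_softmax_sub_le hβ h 0) le_rfl l).1
    calc ∫ x : ι → ℝ, Real.exp (l * ((⨆ i, x i) - b)) ∂ν
        ≤ ∫ x : ι → ℝ, Real.exp (|l| * (β⁻¹ * L)) * Real.exp (l * (softmax β x - B)) ∂ν := by
          refine integral_mono (integrable_exp_iSup_eval ν l b) (hFexp.const_mul _) fun x => ?_
          simp only [← Real.exp_add]
          refine Real.exp_le_exp.2 ?_
          have h1 := iSup_le_softmax hβ x
          have h2 := softmax_le_iSup_add hβ x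
          -- The pointwise gap between softmax and maximum and the gap between their means both lie
          -- in [0, L/β], so they differ by at most L/β.
          have h3 : l * (((⨆ i, x i) - b) - (softmax β x - B)) ≤ |l| * (β⁻¹ * L) := by
            refine (le_abs_self _).trans ?_
            rw [abs_mul]
            gcongr
            rw [abs_le]
            constructor <;> linarith
          linarith
      _ ≤ _ := by
          rw [integral_const_mul]
          gcongr
          exact integral_exp_softmax_le ν hν hS hβ l
  refine ge_of_tendsto' (x := atTop) ?_ hbound
  have hlim : Tendsto (fun n : ℕ => (((n + 1 : ℕ) : ℝ))⁻¹) atTop (𝓝 0) :=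
    (tendsto_natCast_atTop_atTop.comp (tendsto_add_atTop_nat 1)).inv_tendsto_atTop
  have := (hlim.mul_const L).const_mul |l|
  rw [zero_mul, mul_zero] at this
  have := ((Real.continuous_exp.tendsto _).comp this).mul_const (Real.exp (l ^ 2 * S / 2))
  simpa using this

end FiniteMaximum

/-! ### Reduction of suprema to countably many times -/

section Sampling

/-- A sequence of times that is dense in the unit interval and contains its end points. -/
noncomputable def denseTime : ℕ → unitInterval
  | 0 => 0
  | 1 => 1
  | n + 2 => TopologicalSpace.denseSeq unitInterval n

/-- A sequence of times in `[0, t]`, dense from the right, that contains `0` and `t`. -/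
noncomputable def sampleTime (t : unitInterval) (n : ℕ) : Set.Iic t :=
  ⟨min t (denseTime n), Set.mem_Iic.2 (min_le_left t (denseTime n))⟩

/-- Right-continuity of a real path. -/
def RightCts (f : unitInterval → ℝ) : Prop := ∀ t, ContinuousWithinAt f (Set.Ici t) t

/-- For s < t the inequality persists on an interval to the right of s, which meets the dense
sequence. At s = t there is no room inside [0, t], so t must itself be a sample time; index 1
provides it. -/
lemma RightCts.exists_sampleTime_gt {f : unitInterval → ℝ} (hf : RightCts f)
    {t s : unitInterval} (hs : s ≤ t) {c : ℝ} (hc : c < f s) :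
    ∃ n, c < f (sampleTime t n) := by
  rcases hs.eq_or_lt with rfl | hst
  · refine ⟨1, ?_⟩
    simpa [sampleTime, denseTime, min_eq_left (show s ≤ 1 from s.2.2)] using hc
  · have h1 : {u | c < f u} ∈ 𝓝[≥] s := (hf s).eventually_const_lt hc
    obtain ⟨u, hu, hsub⟩ := (mem_nhdsGE_iff_exists_Ico_subset' hst).1 h1
    have hne : (Set.Ioo s (min u t)).Nonempty := exists_between (lt_min hu hst)
    obtain ⟨n, hy⟩ := (TopologicalSpace.denseRange_denseSeq unitInterval).exists_mem_open
      isOpen_Ioo hne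
    refine ⟨n + 2, ?_⟩
    have h2 : (sampleTime t (n + 2) : unitInterval) =
        TopologicalSpace.denseSeq unitInterval n :=
      min_eq_right (hy.2.trans_le (min_le_right _ _)).le
    rw [h2]
    exact hsub ⟨hy.1.le, hy.2.trans_le (min_le_left _ _)⟩

/-- Comparing upper bounds rather than suprema also covers unbounded paths. -/
lemma RightCts.upperBounds_eq {f : unitInterval → ℝ} (hf : RightCts f) (t : unitInterval) :
    upperBounds (Set.range fun s : Set.Iic t => f s) =
      upperBounds (Set.range fun n => f (sampleTime t n)) := by
  ext b
  simp only [mem_upperBounds, Set.forall_mem_range]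
  refine ⟨fun h n => h _, fun h s => ?_⟩
  by_contra! hlt
  obtain ⟨n, hn⟩ := hf.exists_sampleTime_gt s.2 hlt
  exact absurd (h n) (not_le.2 hn)

lemma RightCts.iSup_eq {f : unitInterval → ℝ} (hf : RightCts f) (t : unitInterval) :
    ⨆ s : Set.Iic t, f s = ⨆ n, f (sampleTime t n) := by
  have h := hf.upperBounds_eq t
  by_cases hb : BddAbove (Set.range fun s : Set.Iic t => f s)
  · have h1 := isLUB_ciSup hb
    have hb' : BddAbove (Set.range fun n => f (sampleTime t n)) := by
      rw [BddAbove, ← h]; exact hb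
    have h2 := isLUB_ciSup hb'
    rw [IsLUB, ← h] at h2
    exact h1.unique h2
  · have hb' : ¬ BddAbove (Set.range fun n => f (sampleTime t n)) := by
      rw [BddAbove, ← h]; exact hb
    rw [Real.iSup_of_not_bddAbove hb, Real.iSup_of_not_bddAbove hb']

end Sampling

/-! ### Integrability and concentration of the running supremum -/

section RunningSupremum

variable {Ω : Type*} [MeasurableSpace Ω]

/-- The hypotheses on a component of the process. -/
structure RegularGaussian (Y : unitInterval → Ω → ℝ) (P : Measure Ω) : Prop where
  admissible : IsAdmissibleGaussian Y P
  measurable : ∀ s, Measurable (Y s)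
  rightCts : ∀ ω, RightCts fun s => Y s ω
  zero : ∀ ω, Y 0 ω = 0

/-- The running supremum of a process. -/
noncomputable def runningSup (Y : unitInterval → Ω → ℝ) (t : unitInterval) (ω : Ω) : ℝ :=
  ⨆ s : Set.Iic t, Y s ω

/-- The maximum over the first sample times. -/
noncomputable def sampleMax (Y : unitInterval → Ω → ℝ) (t : unitInterval) (n : ℕ) (ω : Ω) : ℝ :=
  ⨆ i : Fin (n + 1), Y (sampleTime t i) ω

variable {P : Measure Ω} [IsProbabilityMeasure P] {Y : unitInterval → Ω → ℝ}

lemma RegularGaussian.measurable_runningSup (hY : RegularGaussian Y P) (t : unitInterval) :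
    Measurable (runningSup Y t) := by
  have : runningSup Y t = fun ω => ⨆ n, Y (sampleTime t n) ω := by
    ext ω; exact (hY.rightCts ω).iSup_eq t
  rw [this]
  exact Measurable.iSup fun n => hY.measurable _

lemma RegularGaussian.measurable_sampleMax (hY : RegularGaussian Y P) (t : unitInterval) (n : ℕ) :
    Measurable (sampleMax Y t n) :=
  Measurable.iSup fun _ => hY.measurable _

lemma RegularGaussian.ae_bddAbove (hY : RegularGaussian Y P) {t : unitInterval} (ht : 0 < t) :
    ∀ᵐ ω ∂P, BddAbove (Set.range fun s : Set.Iic t => Y s ω) := by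
  filter_upwards [hY.admissible.bounded t ht] with ω h
  rwa [Set.image_eq_range] at h

lemma le_runningSup {t : unitInterval} {ω : Ω}
    (hb : BddAbove (Set.range fun s : Set.Iic t => Y s ω)) {s : unitInterval} (hs : s ≤ t) :
    Y s ω ≤ runningSup Y t ω :=
  le_ciSup hb ⟨s, hs⟩

lemma sampleMax_le_runningSup {t : unitInterval} {ω : Ω}
    (hb : BddAbove (Set.range fun s : Set.Iic t => Y s ω)) (n : ℕ) :
    sampleMax Y t n ω ≤ runningSup Y t ω :=
  ciSup_le fun i => le_runningSup hb (sampleTime t i).2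

lemma le_sampleMax (Y : unitInterval → Ω → ℝ) (t : unitInterval) {i n : ℕ} (h : i ≤ n) (ω : Ω) :
    Y (sampleTime t i) ω ≤ sampleMax Y t n ω :=
  le_ciSup (f := fun i : Fin (n + 1) => Y (sampleTime t i) ω) (Set.finite_range _).bddAbove
    ⟨i, Nat.lt_succ_of_le h⟩

lemma monotone_sampleMax (Y : unitInterval → Ω → ℝ) (t : unitInterval) (ω : Ω) :
    Monotone fun n => sampleMax Y t n ω := fun _ _ h =>
  ciSup_le fun i => le_sampleMax Y t ((Nat.lt_succ_iff.1 i.2).trans h) ω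

lemma RegularGaussian.sampleMax_nonneg (hY : RegularGaussian Y P) (t : unitInterval) (n : ℕ)
    (ω : Ω) : 0 ≤ sampleMax Y t n ω := by
  have h := le_sampleMax Y t (Nat.zero_le n) ω
  have h0 : (sampleTime t 0 : unitInterval) = 0 :=
    min_eq_right (show (0 : unitInterval) ≤ t from t.2.1)
  rwa [h0, hY.zero] at h

lemma RegularGaussian.runningSup_nonneg (hY : RegularGaussian Y P) (t : unitInterval)
    (ω : Ω) : 0 ≤ runningSup Y t ω := by
  by_cases hb : BddAbove (Set.range fun s : Set.Iic t => Y s ω)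
  · have := le_runningSup hb (show (0 : unitInterval) ≤ t from t.2.1)
    rwa [hY.zero] at this
  · exact (Real.iSup_of_not_bddAbove hb).ge

lemma RegularGaussian.tendsto_sampleMax (hY : RegularGaussian Y P) {t : unitInterval} {ω : Ω}
    (hb : BddAbove (Set.range fun s : Set.Iic t => Y s ω)) :
    Tendsto (fun n => sampleMax Y t n ω) atTop (𝓝 (runningSup Y t ω)) := by
  refine tendsto_order.2 ⟨fun a ha => ?_, fun a ha => ?_⟩
  · obtain ⟨s, hs⟩ := exists_lt_of_lt_ciSup ha
    obtain ⟨n, hn⟩ := (hY.rightCts ω).exists_sampleTime_gt s.2 hs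
    filter_upwards [eventually_ge_atTop n] with m hm
    exact hn.trans_le (le_sampleMax Y t hm ω)
  · exact Eventually.of_forall fun n => (sampleMax_le_runningSup hb n).trans_lt ha

/-- The law of the values of the process at the first sample times. -/
noncomputable def sampleLaw (Y : unitInterval → Ω → ℝ) (P : Measure Ω) (t : unitInterval)
    (n : ℕ) : Measure (Fin (n + 1) → ℝ) :=
  P.map fun ω i => Y (sampleTime t i) ω

lemma RegularGaussian.isGaussian_sampleLaw (hY : RegularGaussian Y P) (t : unitInterval)
    (n : ℕ) : IsGaussian (sampleLaw Y P t n) := by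
  have h := (hY.admissible.gaussian.comp_right
    (fun i : Fin (n + 1) => (sampleTime t i : unitInterval))).hasGaussianLaw Finset.univ
  exact (h.map_fun (ContinuousLinearMap.pi fun i : Fin (n + 1) =>
    ContinuousLinearMap.proj (R := ℝ)
      (φ := fun _ : (Finset.univ : Finset (Fin (n + 1))) => ℝ) ⟨i, Finset.mem_univ i⟩)).isGaussian_map

lemma RegularGaussian.measurable_sample (hY : RegularGaussian Y P) (t : unitInterval)
    (n : ℕ) : Measurable fun ω (i : Fin (n + 1)) => Y (sampleTime t i) ω :=
  measurable_pi_lambda _ fun _ => hY.measurable _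

lemma RegularGaussian.memLp_two (hY : RegularGaussian Y P) (s : unitInterval) :
    MemLp (Y s) 2 P :=
  (hY.admissible.gaussian.hasGaussianLaw_eval s).memLp_two

lemma RegularGaussian.integral_sampleLaw (hY : RegularGaussian Y P) (t : unitInterval)
    (n : ℕ) : ∫ x, x ∂(sampleLaw Y P t n) = 0 := by
  have := hY.isGaussian_sampleLaw t n
  ext i
  have h := IsGaussian.integral_dual (μ := sampleLaw Y P t n)
    (ContinuousLinearMap.proj i : StrongDual ℝ (Fin (n + 1) → ℝ))
  simp only [ContinuousLinearMap.proj_apply] at h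
  rw [← h, sampleLaw, integral_map (hY.measurable_sample t n).aemeasurable
    (measurable_pi_apply i).aestronglyMeasurable]
  exact hY.admissible.mean_zero _

/-- The variance proxy does not depend on the number of sample times, so every consequence passes to
the full supremum. -/
lemma RegularGaussian.hasSubgaussianMGF_sampleMax (hY : RegularGaussian Y P) {t : unitInterval}
    {S : ℝ≥0} (hS : ∀ s ≤ t, ∫ ω, Y s ω ^ 2 ∂P ≤ S) (n : ℕ) :
    Integrable (sampleMax Y t n) P ∧
    HasSubgaussianMGF (fun ω => sampleMax Y t n ω - ∫ ω', sampleMax Y t n ω' ∂P) S P := by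
  have hg := hY.isGaussian_sampleLaw t n
  have hm := hY.measurable_sample t n
  have hmean : ∫ y : Fin (n + 1) → ℝ, ⨆ i, y i ∂(sampleLaw Y P t n) =
      ∫ ω', sampleMax Y t n ω' ∂P :=
    integral_map hm.aemeasurable measurable_iSup_eval.aestronglyMeasurable
  refine ⟨(integrable_iSup_eval (sampleLaw Y P t n)).comp_measurable hm, ⟨fun l => ?_,
    fun l => ?_⟩⟩
  · rw [← hmean]
    exact (integrable_exp_iSup_eval (sampleLaw Y P t n) l _).comp_measurable hm
  · have h := integral_exp_iSup_le (sampleLaw Y P t n) (hY.integral_sampleLaw t n) (S := S)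
      (fun i => by
        rw [sampleLaw, integral_map hm.aemeasurable
          ((measurable_pi_apply i).pow_const 2).aestronglyMeasurable]
        exact hS _ (sampleTime t i).2) l
    rw [hmean, sampleLaw, integral_map hm.aemeasurable
      (((measurable_iSup_eval.sub_const _).const_mul l).exp.aestronglyMeasurable)] at h
    rw [mgf, mul_comm (S : ℝ)]
    exact h

lemma exists_measure_gt_lt {f : Ω → ℝ} (hf : Measurable f) {c : ℝ≥0∞} (hc : 0 < c) :
    ∃ K : ℝ, 0 ≤ K ∧ P {ω | K < f ω} < c := by
  have h := tendsto_measure_iInter_atTop (μ := P) (s := fun n : ℕ => {ω | (n : ℝ) < f ω})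
    (fun n => (measurableSet_lt measurable_const hf).nullMeasurableSet)
    (fun m n hmn ω hω => lt_of_le_of_lt (Nat.cast_le.2 hmn : (m : ℝ) ≤ n) hω) ⟨0, measure_ne_top _ _⟩
  have he : ⋂ n : ℕ, {ω | (n : ℝ) < f ω} = ∅ := by
    ext ω
    simp only [Set.mem_iInter, Set.mem_ofPred_eq, Set.mem_empty_iff_false, iff_false, not_forall,
      not_lt]
    exact exists_nat_ge (f ω)
  rw [he, measure_empty] at h
  obtain ⟨n, hn⟩ := (h.eventually (gt_mem_nhds hc)).exists
  exact ⟨n, n.cast_nonneg, hn⟩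

/-- The probability that a standard Gaussian variable exceeds `1`. -/
noncomputable def gaussianTail : ℝ≥0∞ := gaussianReal 0 1 (Set.Ioi 1)

lemma gaussianTail_pos : 0 < gaussianTail := by
  refine pos_iff_ne_zero.2 fun h => ?_
  have := gaussianReal_absolutelyContinuous' 0 one_ne_zero h
  simp at this

lemma gaussianTail_ne_top : gaussianTail ≠ ∞ := measure_ne_top _ _

lemma RegularGaussian.measure_sqrt_lt (hY : RegularGaussian Y P) {s : unitInterval}
    (hv : 0 < ∫ ω, Y s ω ^ 2 ∂P) :
    P {ω | √(∫ ω, Y s ω ^ 2 ∂P) < Y s ω} = gaussianTail := by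
  set v := ∫ ω, Y s ω ^ 2 ∂P with hvdef
  have hlaw := (hY.admissible.gaussian.hasGaussianLaw_eval s).map_eq_gaussianReal
  have hvar : Var[Y s; P] = v := by
    rw [variance_eq_integral (hY.measurable s).aemeasurable, hY.admissible.mean_zero]
    simp [hvdef]
  rw [hvar, hY.admissible.mean_zero] at hlaw
  have hsc : gaussianReal 0 v.toNNReal = (gaussianReal 0 1).map (fun x => √v * x) := by
    rw [gaussianReal_map_const_mul]
    congr 1
    · simp
    · ext; simp [Real.sq_sqrt hv.le, hv.le]
  have hsq : 0 < √v := Real.sqrt_pos.2 hv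
  have : P {ω | √v < Y s ω} = P.map (Y s) (Set.Ioi √v) := by
    rw [Measure.map_apply (hY.measurable s) measurableSet_Ioi]; rfl
  rw [this, hlaw, hsc, Measure.map_apply (by fun_prop) measurableSet_Ioi, gaussianTail]
  congr 1
  ext x
  exact lt_mul_iff_one_lt_right hsq

/-- A quantile argument: choose K with P(sup > K) below the chance that a Gaussian exceeds its
standard deviation. A variance above K² would make that fixed chance a lower bound for P(sup > K).
-/
lemma RegularGaussian.bddAbove_variance (hY : RegularGaussian Y P) {t : unitInterval}
    (ht : 0 < t) : BddAbove (Set.range fun s : Set.Iic t => ∫ ω, Y s ω ^ 2 ∂P) := by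
  obtain ⟨K, hK0, hK⟩ := exists_measure_gt_lt (P := P) (hY.measurable_runningSup t)
    gaussianTail_pos
  refine ⟨K ^ 2, ?_⟩
  rintro _ ⟨s, rfl⟩
  by_contra! hlt
  have hv : 0 < ∫ ω, Y s ω ^ 2 ∂P := (sq_nonneg K).trans_lt hlt
  have h1 := hY.measure_sqrt_lt hv
  refine absurd hK (not_lt.2 ?_)
  rw [← h1]
  refine measure_mono_ae ?_
  filter_upwards [hY.ae_bddAbove ht] with ω hb hω
  exact ((Real.lt_sqrt hK0).2 hlt).trans (lt_of_lt_of_le hω (le_runningSup hb s.2))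

lemma RegularGaussian.le_supVariance (hY : RegularGaussian Y P) {t : unitInterval}
    (ht : 0 < t) {s : unitInterval} (hs : s ≤ t) : ∫ ω, Y s ω ^ 2 ∂P ≤ supVariance Y P t :=
  le_ciSup (hY.bddAbove_variance ht) ⟨s, hs⟩

lemma RegularGaussian.variance_pos (hY : RegularGaussian Y P) {t : unitInterval}
    (ht : 0 < t) : 0 < ∫ ω, Y t ω ^ 2 ∂P := by
  rw [integral_pos_iff_support_of_nonneg (fun _ => sq_nonneg _) (hY.memLp_two t).integrable_sq]
  simpa [Function.support] using hY.admissible.nondegenerate t ht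

lemma RegularGaussian.supVariance_pos (hY : RegularGaussian Y P) {t : unitInterval}
    (ht : 0 < t) : 0 < supVariance Y P t :=
  (hY.variance_pos ht).trans_le (hY.le_supVariance ht le_rfl)

/-- Almost sure finiteness bounds the means because concentration also acts downwards. If the mean
exceeded K + r, the maximum would exceed K with probability at least 1/2, contrary to the choice of
K. -/
lemma RegularGaussian.integral_sampleMax_bdd (hY : RegularGaussian Y P) {t : unitInterval}
    (ht : 0 < t) : ∃ C, ∀ n, ∫ ω, sampleMax Y t n ω ∂P ≤ C := by
  obtain ⟨K, hK0, hK⟩ := exists_measure_gt_lt (P := P) (hY.measurable_runningSup t)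
    (c := ENNReal.ofReal (1 / 2)) (by simp)
  set S : ℝ≥0 := (supVariance Y P t).toNNReal
  have hSpos := hY.supVariance_pos ht
  have hS : (S : ℝ) = supVariance Y P t := Real.coe_toNNReal _ hSpos.le
  obtain ⟨r, hr0, hr⟩ : ∃ r : ℝ, 0 ≤ r ∧ Real.exp (-r ^ 2 / (2 * S)) ≤ 1 / 2 := by
    -- This value makes the sub-Gaussian tail exactly 1/2.
    refine ⟨√(2 * S * Real.log 2), Real.sqrt_nonneg _, ?_⟩
    have : 0 ≤ 2 * (S : ℝ) * Real.log 2 := by positivity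
    rw [Real.sq_sqrt this]
    have hS' : (S : ℝ) ≠ 0 := by rw [hS]; exact hSpos.ne'
    have : -(2 * (S : ℝ) * Real.log 2) / (2 * S) = -Real.log 2 := by field_simp
    rw [this, Real.exp_neg, Real.exp_log two_pos]; norm_num
  refine ⟨K + r, fun n => ?_⟩
  by_contra! hlt
  set m := ∫ ω, sampleMax Y t n ω ∂P
  obtain ⟨-, hsub⟩ := hY.hasSubgaussianMGF_sampleMax (t := t) (S := S)
    (fun s hs => hS ▸ hY.le_supVariance ht hs) n
  have h1 := (hsub.neg.measure_ge_le hr0).trans hr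
  have h2 : P {ω | r ≤ (-fun ω => sampleMax Y t n ω - m) ω}ᶜ ≤ P {ω | K < runningSup Y t ω} := by
    refine measure_mono_ae ?_
    filter_upwards [hY.ae_bddAbove ht] with ω hb hω
    have h3 := sampleMax_le_runningSup hb n
    have h4 : ¬ (r ≤ -(sampleMax Y t n ω - m)) := hω
    change K < runningSup Y t ω
    linarith
  have hmeas : MeasurableSet {ω | r ≤ (-fun ω => sampleMax Y t n ω - m) ω} :=
    measurableSet_le measurable_const ((hY.measurable_sampleMax t n).sub_const m).neg
  have h5 := (h2.trans_lt hK)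
  rw [← ENNReal.ofReal_toReal (measure_ne_top P _), ENNReal.ofReal_lt_ofReal_iff (by norm_num)]
    at h5
  have h6 := probReal_add_probReal_compl (μ := P) hmeas
  rw [measureReal_def, measureReal_def] at h6
  rw [measureReal_def] at h1
  linarith

lemma RegularGaussian.integrable_runningSup (hY : RegularGaussian Y P) {t : unitInterval}
    (ht : 0 < t) : Integrable (runningSup Y t) P := by
  obtain ⟨C, hC⟩ := hY.integral_sampleMax_bdd ht
  have hint : ∀ n, Integrable (sampleMax Y t n) P := fun n =>
    (hY.hasSubgaussianMGF_sampleMax (t := t) (S := (supVariance Y P t).toNNReal)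
      (fun s hs => (hY.le_supVariance ht hs).trans (Real.le_coe_toNNReal _)) n).1
  refine ⟨(hY.measurable_runningSup t).aestronglyMeasurable, ?_⟩
  rw [HasFiniteIntegral]
  calc ∫⁻ ω, ‖runningSup Y t ω‖ₑ ∂P
      -- Fatou, with the uniform bound on the means of the finite maxima.
      ≤ ∫⁻ ω, liminf (fun n => ‖sampleMax Y t n ω‖ₑ) atTop ∂P := by
        refine lintegral_mono_ae ?_
        filter_upwards [hY.ae_bddAbove ht] with ω hb
        exact (((continuous_enorm.tendsto _).comp (hY.tendsto_sampleMax hb)).liminf_eq).ge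
    _ ≤ liminf (fun n => ∫⁻ ω, ‖sampleMax Y t n ω‖ₑ ∂P) atTop :=
        lintegral_liminf_le fun n => (hY.measurable_sampleMax t n).enorm
    _ ≤ ENNReal.ofReal C := by
        refine liminf_le_of_le (by isBoundedDefault) fun b hb => ?_
        obtain ⟨n, hn⟩ := hb.exists
        refine hn.trans ?_
        have : ∀ ω, ‖sampleMax Y t n ω‖ₑ = ENNReal.ofReal (sampleMax Y t n ω) := fun ω =>
          Real.enorm_of_nonneg (hY.sampleMax_nonneg t n ω)
        simp_rw [this]
        rw [← ofReal_integral_eq_lintegral_ofReal (hint n)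
          (ae_of_all _ (hY.sampleMax_nonneg t n))]
        exact ENNReal.ofReal_le_ofReal (hC n)
    _ < ∞ := ENNReal.ofReal_lt_top

/-- The Borell–Tsirelson–Ibragimov–Sudakov inequality. -/
lemma RegularGaussian.measure_runningSup_ge_le (hY : RegularGaussian Y P) {t : unitInterval}
    (ht : 0 < t) {r : ℝ} (hr : expectedSup Y P t < r) :
    P {ω | r ≤ runningSup Y t ω} ≤
      ENNReal.ofReal (Real.exp (-(r - expectedSup Y P t) ^ 2 / (2 * supVariance Y P t))) := by
  set μ := expectedSup Y P t with hμ
  set S : ℝ≥0 := (supVariance Y P t).toNNReal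
  have hSpos := hY.supVariance_pos ht
  have hS : (S : ℝ) = supVariance Y P t := Real.coe_toNNReal _ hSpos.le
  rw [← hS]
  have hsub := hY.hasSubgaussianMGF_sampleMax (t := t) (S := S)
    (fun s hs => hS ▸ hY.le_supVariance ht hs)
  have hm : ∀ n, ∫ ω, sampleMax Y t n ω ∂P ≤ μ := fun n =>
    integral_mono_ae (hsub n).1 (hY.integrable_runningSup ht) (by
      filter_upwards [hY.ae_bddAbove ht] with ω hb using sampleMax_le_runningSup hb n)
  -- A finite maximum need not attain the level r even when the supremum does, but it eventually
  -- passes every r' < r. The deviation is measured from the means of the finite maxima, which are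
  -- at most μ; then r' ↑ r.
  have key : ∀ r', μ < r' → r' < r → P {ω | r ≤ runningSup Y t ω} ≤
      ENNReal.ofReal (Real.exp (-(r' - μ) ^ 2 / (2 * S))) := fun r' h1 h2 => by
    have hmono : Monotone fun n => {ω | r' < sampleMax Y t n ω} := fun m n hmn ω hω =>
      lt_of_lt_of_le hω (monotone_sampleMax Y t ω hmn)
    calc P {ω | r ≤ runningSup Y t ω} ≤ P (⋃ n, {ω | r' < sampleMax Y t n ω}) := by
          refine measure_mono_ae ?_
          filter_upwards [hY.ae_bddAbove ht] with ω hb hω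
          have h3 : r' < runningSup Y t ω := h2.trans_le hω
          obtain ⟨n, hn⟩ := ((hY.tendsto_sampleMax hb).eventually (lt_mem_nhds h3)).exists
          exact Set.mem_iUnion.2 ⟨n, hn⟩
      _ ≤ ENNReal.ofReal (Real.exp (-(r' - μ) ^ 2 / (2 * S))) := by
          refine le_of_tendsto' (tendsto_measure_iUnion_atTop hmono) fun n => ?_
          have h4 : 0 ≤ r' - ∫ ω, sampleMax Y t n ω ∂P := by linarith [hm n]
          have h5 := (hsub n).2.measure_ge_le h4
          rw [measureReal_def] at h5
          calc P {ω | r' < sampleMax Y t n ω}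
              ≤ P {ω | r' - ∫ ω, sampleMax Y t n ω ∂P ≤
                  sampleMax Y t n ω - ∫ ω, sampleMax Y t n ω ∂P} := by
                refine measure_mono fun ω hω => ?_
                have : r' < sampleMax Y t n ω := hω
                simp only [Set.mem_ofPred_eq]; linarith
            _ ≤ _ := by
                refine (ENNReal.le_ofReal_iff_toReal_le (measure_ne_top _ _)
                  (Real.exp_pos _).le).2 (h5.trans ?_)
                refine Real.exp_le_exp.2 ?_
                have h6 := hm n
                gcongr
  have hc : Tendsto (fun r' => ENNReal.ofReal (Real.exp (-(r' - μ) ^ 2 / (2 * S)))) (𝓝[<] r)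
      (𝓝 (ENNReal.ofReal (Real.exp (-(r - μ) ^ 2 / (2 * S))))) :=
    (ENNReal.continuous_ofReal.comp (by fun_prop)).continuousWithinAt.tendsto
  refine ge_of_tendsto hc ?_
  filter_upwards [Ioo_mem_nhdsLT hr] with r' hr' using key r' hr'.1 hr'.2

end RunningSupremum

/-! ### Comparison of σ with μ, smallness of μ, and symmetry -/

section SupremumMoments

variable {Ω : Type*} [MeasurableSpace Ω]
variable {P : Measure Ω} [IsProbabilityMeasure P] {Y : unitInterval → Ω → ℝ}

/-- Markov's inequality at the level of one standard deviation of `Y s`, which `Y s` alone exceeds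
with probability `gaussianTail`. -/
lemma RegularGaussian.tail_mul_sqrt_le (hY : RegularGaussian Y P) {t : unitInterval}
    (ht : 0 < t) {s : unitInterval} (hs : s ≤ t) :
    gaussianTail.toReal * √(∫ ω, Y s ω ^ 2 ∂P) ≤ expectedSup Y P t := by
  have h0 : 0 ≤ expectedSup Y P t := integral_nonneg (hY.runningSup_nonneg t)
  rcases (integral_nonneg fun ω => sq_nonneg (Y s ω) : 0 ≤ ∫ ω, Y s ω ^ 2 ∂P).eq_or_lt with hv | hv
  · rw [← hv]; simpa using h0
  · have h1 := mul_meas_ge_le_integral_of_nonneg (ae_of_all P (hY.runningSup_nonneg t))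
      (hY.integrable_runningSup ht) √(∫ ω, Y s ω ^ 2 ∂P)
    refine le_trans ?_ h1
    rw [mul_comm]
    refine mul_le_mul_of_nonneg_left ?_ (Real.sqrt_nonneg _)
    rw [measureReal_def, ← hY.measure_sqrt_lt hv]
    refine ENNReal.toReal_mono (measure_ne_top _ _) (measure_mono_ae ?_)
    filter_upwards [hY.ae_bddAbove ht] with ω hb hω
    exact (le_of_lt hω).trans (le_runningSup hb hs)

lemma RegularGaussian.sq_tail_mul_supVariance_le (hY : RegularGaussian Y P) {t : unitInterval}
    (ht : 0 < t) : gaussianTail.toReal ^ 2 * supVariance Y P t ≤ expectedSup Y P t ^ 2 := by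
  have hg : 0 < gaussianTail.toReal := ENNReal.toReal_pos gaussianTail_pos.ne' gaussianTail_ne_top
  have hne : Nonempty (Set.Iic t) := ⟨⟨t, Set.mem_Iic.2 le_rfl⟩⟩
  rw [← le_div_iff₀' (by positivity)]
  refine ciSup_le fun s => ?_
  rw [le_div_iff₀' (by positivity)]
  have h := hY.tail_mul_sqrt_le ht (Set.mem_Iic.1 s.2)
  have h0 : 0 ≤ ∫ ω, Y s ω ^ 2 ∂P := integral_nonneg fun ω => sq_nonneg _
  calc _ = (gaussianTail.toReal * √(∫ ω, Y s ω ^ 2 ∂P)) ^ 2 := by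
        rw [mul_pow, Real.sq_sqrt h0]
    _ ≤ _ := by gcongr

lemma RegularGaussian.expectedSup_pos (hY : RegularGaussian Y P) {t : unitInterval}
    (ht : 0 < t) : 0 < expectedSup Y P t :=
  lt_of_lt_of_le (mul_pos (ENNReal.toReal_pos gaussianTail_pos.ne' gaussianTail_ne_top)
    (Real.sqrt_pos.2 (hY.variance_pos ht))) (hY.tail_mul_sqrt_le ht le_rfl)

/-- Right-continuity at 0 sends the running supremum to 0 on every path, and the supremum over [0,
1] dominates. -/
lemma RegularGaussian.tendsto_expectedSup (hY : RegularGaussian Y P) :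
    Tendsto (fun t => expectedSup Y P t) (𝓝[>] (0 : unitInterval)) (𝓝 0) := by
  have h := tendsto_integral_filter_of_dominated_convergence (μ := P)
    (l := 𝓝[>] (0 : unitInterval)) (F := runningSup Y) (f := fun _ => (0 : ℝ))
    (runningSup Y 1) (Eventually.of_forall fun t => (hY.measurable_runningSup t).aestronglyMeasurable)
    (Eventually.of_forall fun t => ?_) (hY.integrable_runningSup zero_lt_one) ?_
  · simpa [expectedSup, runningSup] using h
  · filter_upwards [hY.ae_bddAbove (t := 1) zero_lt_one] with ω hb
    rw [Real.norm_of_nonneg (hY.runningSup_nonneg t ω)]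
    have hne : Nonempty (Set.Iic t) := ⟨⟨t, Set.mem_Iic.2 le_rfl⟩⟩
    exact ciSup_le fun s => le_runningSup hb unitInterval.le_one'
  · refine ae_of_all P fun ω => ?_
    refine tendsto_order.2 ⟨fun a ha => ?_, fun a ha => ?_⟩
    · exact Eventually.of_forall fun t => ha.trans_le (hY.runningSup_nonneg t ω)
    · have h1 : {u | Y u ω < a / 2} ∈ 𝓝[≥] (0 : unitInterval) :=
        (hY.rightCts ω 0).eventually_lt_const (by simp only [hY.zero]; linarith)
      obtain ⟨u, hu, hsub⟩ := (mem_nhdsGE_iff_exists_Ico_subset' zero_lt_one).1 h1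
      filter_upwards [Ioo_mem_nhdsGT hu] with t ht
      have hne : Nonempty (Set.Iic t) := ⟨⟨t, Set.mem_Iic.2 le_rfl⟩⟩
      have : runningSup Y t ω ≤ a / 2 := ciSup_le fun s =>
        (hsub ⟨unitInterval.nonneg', (Set.mem_Iic.1 s.2).trans_lt ht.2⟩).le
      linarith

/-- The finite-dimensional laws are centred Gaussian, so their characteristic functions depend on
variances only and are even. -/
lemma RegularGaussian.identDistrib_neg (hY : RegularGaussian Y P) :
    IdentDistrib (fun ω s => -Y s ω) (fun ω s => Y s ω) P P := by
  have hm : ∀ I : Finset unitInterval, Measurable fun ω => I.restrict (Y · ω) := fun I =>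
    measurable_pi_lambda _ fun _ => hY.measurable _
  refine (identDistrib_iff_forall_finset_identDistrib (X := fun s ω => -Y s ω) (Y := Y)
    (measurable_pi_lambda _ fun s => (hY.measurable s).neg).aemeasurable
    (measurable_pi_lambda _ fun s => hY.measurable s).aemeasurable).2 fun I => ?_
  refine ⟨(measurable_pi_lambda _ fun _ => (hY.measurable _).neg).aemeasurable,
    (hm I).aemeasurable, ?_⟩
  set ν := P.map fun ω => I.restrict (Y · ω) with hν
  have hg : IsGaussian ν := (hY.admissible.gaussian.hasGaussianLaw I).isGaussian_map
  have hneg : P.map (fun ω => I.restrict fun s => -Y s ω) = ν.map (fun x => -x) := by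
    rw [hν, Measure.map_map (by fun_prop) (hm I)]
    rfl
  have hmean : ∫ x, x ∂ν = 0 := by
    ext i
    have h := IsGaussian.integral_dual (μ := ν)
      (ContinuousLinearMap.proj i : StrongDual ℝ (I → ℝ))
    simp only [ContinuousLinearMap.proj_apply] at h
    rw [← h, hν, integral_map (hm I).aemeasurable (measurable_pi_apply i).aestronglyMeasurable]
    exact hY.admissible.mean_zero _
  rw [hneg]
  refine Measure.ext_of_charFunDual ?_
  ext T
  have h1 : T.comp (-ContinuousLinearMap.id ℝ (I → ℝ)) = -T := by ext; simp
  have h2 : ν.map (fun x => -x) = ν.map (-ContinuousLinearMap.id ℝ (I → ℝ)) := rfl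
  rw [h2, charFunDual_map, h1, IsGaussian.charFunDual_eq_of_integral_eq_zero hmean,
    IsGaussian.charFunDual_eq_of_integral_eq_zero hmean]
  congr 3
  rw [FunLike.coe_neg]
  norm_cast
  exact variance_neg

/-- A path of a process with the law of `Y` reaches the level `r` before `t` with at most the
probability with which the running supremum of `Y` does. -/
lemma RegularGaussian.measure_exists_ge_le (hY : RegularGaussian Y P)
    {Z : unitInterval → Ω → ℝ} (hZ : ∀ ω, RightCts fun s => Z s ω)
    (hZY : IdentDistrib (fun ω s => Z s ω) (fun ω s => Y s ω) P P)
    {t : unitInterval} (ht : 0 < t) (r : ℝ) :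
    P {ω | ∃ s ≤ t, r ≤ Z s ω} ≤ P {ω | r ≤ runningSup Y t ω} := by
  -- Equality in law transfers only events measurable for the product σ-algebra, so hitting r is
  -- replaced by coming within 1/(k+1) of r at some sample time, for every k.
  set B : Set (unitInterval → ℝ) :=
    ⋂ k : ℕ, ⋃ n : ℕ, {f | r - 1 / ((k : ℝ) + 1) < f (sampleTime t n)} with hB
  have hBm : MeasurableSet B := MeasurableSet.iInter fun k => MeasurableSet.iUnion fun n =>
    measurableSet_lt measurable_const (measurable_pi_apply _)
  have hk : ∀ k : ℕ, 0 < 1 / ((k : ℝ) + 1) := fun k => Nat.one_div_pos_of_nat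
  calc P {ω | ∃ s ≤ t, r ≤ Z s ω} ≤ P ((fun ω s => Z s ω) ⁻¹' B) := by
        refine measure_mono fun ω hω => ?_
        obtain ⟨s, hs, hr⟩ := hω
        refine Set.mem_iInter.2 fun k => Set.mem_iUnion.2 ?_
        exact (hZ ω).exists_sampleTime_gt hs (by linarith [hk k])
    _ = P ((fun ω s => Y s ω) ⁻¹' B) := hZY.measure_mem_eq hBm
    _ ≤ P {ω | r ≤ runningSup Y t ω} := by
        refine measure_mono_ae ?_
        filter_upwards [hY.ae_bddAbove ht] with ω hb hω
        refine le_of_forall_pos_lt_add fun ε hε => ?_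
        obtain ⟨k, hkε⟩ := exists_nat_one_div_lt hε
        obtain ⟨n, hn⟩ := Set.mem_iUnion.1 (Set.mem_iInter.1 hω k)
        have h1 : r - 1 / ((k : ℝ) + 1) < Y (sampleTime t n) ω := hn
        have h2 := le_runningSup hb (Set.mem_Iic.1 (sampleTime t n).2)
        linarith

end SupremumMoments

/-! ### Normal fields from the two-sided ball condition -/

section Normals

open scoped RealInnerProductSpace

variable {V : Type*} [NormedAddCommGroup V] [InnerProductSpace ℝ V]

/-- The field `N` of unit vectors on the set `F` behaves like a unit normal field of a
hypersurface with two-sided tangent balls of radius `R`. -/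
structure IsNormalField (F : Set V) (R : ℝ) (N : V → V) : Prop where
  norm_eq : ∀ p ∈ F, ‖N p‖ = 1
  tangent : ∀ p ∈ F, ∀ q ∈ F, 2 * R * |⟪q - p, N p⟫| ≤ ‖q - p‖ ^ 2
  lipschitz : ∀ p ∈ F, ∀ q ∈ F, R * ‖N p - N q‖ ≤ ‖p - q‖

/-- Interior and exterior tangent balls along `N`. -/
structure HasTangentBalls (D : Set V) (R : ℝ) (N : V → V) : Prop where
  norm_eq : ∀ p ∈ frontier D, ‖N p‖ = 1
  interior : ∀ p ∈ frontier D, Metric.ball (p + R • N p) R ⊆ D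
  exterior : ∀ p ∈ frontier D, Metric.ball (p - R • N p) R ⊆ (closure D)ᶜ

lemma HasTangentBalls.isNormalField {D : Set V} (hD : IsOpen D) {R : ℝ} (hR : 0 < R) {N : V → V}
    (h : HasTangentBalls D R N) : IsNormalField (frontier D) R N where
  norm_eq := h.norm_eq
  tangent p hp q hq := by
    have h1 : q ∉ Metric.ball (p + R • N p) R := fun hmem => by
      rw [hD.frontier_eq] at hq
      exact hq.2 (h.interior p hp hmem)
    have h2 : q ∉ Metric.ball (p - R • N p) R := fun hmem =>
      h.exterior p hp hmem (frontier_subset_closure hq)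
    rw [Metric.mem_ball, not_lt, dist_eq_norm] at h1 h2
    have e1 : q - (p + R • N p) = (q - p) - R • N p := by abel
    have e2 : q - (p - R • N p) = (q - p) + R • N p := by abel
    rw [e1] at h1
    rw [e2] at h2
    have h1' := pow_le_pow_left₀ hR.le h1 2
    have h2' := pow_le_pow_left₀ hR.le h2 2
    rw [norm_sub_sq_real, inner_smul_right, norm_smul, h.norm_eq p hp, Real.norm_of_nonneg hR.le]
      at h1'
    rw [norm_add_sq_real, inner_smul_right, norm_smul, h.norm_eq p hp, Real.norm_of_nonneg hR.le]
      at h2'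
    have e : 2 * R * |⟪q - p, N p⟫| = |2 * (R * ⟪q - p, N p⟫)| := by
      rw [abs_mul, abs_mul, abs_two, abs_of_pos hR, mul_assoc]
    rw [e, abs_le]
    constructor <;> linarith
  lipschitz p hp q hq := by
    -- The interior ball at p and the exterior ball at q are disjoint, so their centres are at least
    -- 2R apart. Adding the inequality with p and q exchanged cancels the cross term, and the
    -- parallelogram law turns ‖N p + N q‖ into ‖N p - N q‖.
    have key : ∀ p ∈ frontier D, ∀ q ∈ frontier D,
        4 * R ^ 2 ≤ ‖p - q‖ ^ 2 + 2 * R * ⟪p - q, N p + N q⟫ + R ^ 2 * ‖N p + N q‖ ^ 2 := by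
      intro p hp q hq
      have hdis : Disjoint (Metric.ball (p + R • N p) R) (Metric.ball (q - R • N q) R) :=
        Set.disjoint_left.2 fun x hx hx' => h.exterior q hq hx'
          (subset_closure (h.interior p hp hx))
      rw [disjoint_ball_ball_iff hR hR, dist_eq_norm] at hdis
      have e : p + R • N p - (q - R • N q) = (p - q) + R • (N p + N q) := by
        rw [smul_add]; abel
      rw [e] at hdis
      have := pow_le_pow_left₀ (by positivity) hdis 2
      rw [norm_add_sq_real, inner_smul_right, norm_smul, Real.norm_of_nonneg hR.le] at this
      nlinarith
    have h1 := key p hp q hq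
    have h2 := key q hq p hp
    have e1 : ⟪q - p, N q + N p⟫ = -⟪p - q, N p + N q⟫ := by
      rw [← neg_sub p q, inner_neg_left, add_comm]
    rw [e1, norm_sub_rev, add_comm (N q)] at h2
    have h3 := parallelogram_law_with_norm ℝ (N p) (N q)
    rw [h.norm_eq p hp, h.norm_eq q hq] at h3
    refine abs_le_of_sq_le_sq' ?_ (norm_nonneg _) |>.2
    nlinarith

/-- The ball is connected, starts in `D` and misses the frontier. -/
lemma ball_infDist_frontier_subset {D : Set V} (hD : IsOpen D) {x : V} (hx : x ∈ D) :
    Metric.ball x (Metric.infDist x (frontier D)) ⊆ D := by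
  rcases (Metric.infDist_nonneg (x := x) (s := frontier D)).eq_or_lt with h0 | hδ
  · simp [← h0]
  refine (convex_ball x _).isPreconnected.subset_left_of_subset_union hD
    isClosed_closure.isOpen_compl
    (Set.disjoint_left.2 fun y hy hy' => hy' (subset_closure hy)) (fun y hy => ?_)
    ⟨x, Metric.mem_ball_self hδ, hx⟩
  by_contra hcon
  rw [Set.mem_union, not_or, Set.mem_compl_iff, not_not] at hcon
  have hyF : y ∈ frontier D := by rw [hD.frontier_eq]; exact ⟨hcon.2, hcon.1⟩
  have := Metric.infDist_le_dist_of_mem (x := x) hyF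
  rw [dist_comm x y] at this
  exact absurd (Metric.mem_ball.1 hy) (not_lt.2 this)

/-- Take a nearest boundary point z. The ball about x through z is disjoint from the exterior ball
at z, which forces equality in Cauchy–Schwarz for x - z and `N z`. -/
lemma HasTangentBalls.exists_eq_add_smul [FiniteDimensional ℝ V] {D : Set V} (hD : IsOpen D)
    {R : ℝ} (hR : 0 < R) {N : V → V} (h : HasTangentBalls D R N) (hne : (frontier D).Nonempty)
    {x : V} (hx : x ∈ D) :
    ∃ z ∈ frontier D, x = z + Metric.infDist x (frontier D) • N z := by
  have : ProperSpace V := FiniteDimensional.proper ℝ V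
  obtain ⟨z, hz, hdist⟩ := isClosed_frontier.exists_infDist_eq_dist hne x
  refine ⟨z, hz, ?_⟩
  rw [hdist]
  have hδ : 0 < dist x z := by
    refine dist_pos.2 fun hxz => ?_
    rw [hD.frontier_eq] at hz
    exact hz.2 (hxz ▸ hx)
  set δ := dist x z with hδdef
  have hball : Metric.ball x δ ⊆ D := hdist ▸ ball_infDist_frontier_subset hD hx
  have hdis : Disjoint (Metric.ball x δ) (Metric.ball (z - R • N z) R) :=
    Set.disjoint_left.2 fun y hy hy' => h.exterior z hz hy' (subset_closure (hball hy))
  rw [disjoint_ball_ball_iff hδ hR, dist_eq_norm] at hdis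
  have e : x - (z - R • N z) = (x - z) + R • N z := by abel
  rw [e] at hdis
  have h1 := pow_le_pow_left₀ (by positivity) hdis 2
  have hn : ‖x - z‖ = δ := (dist_eq_norm x z).symm
  rw [norm_add_sq_real, inner_smul_right, norm_smul, h.norm_eq z hz, Real.norm_of_nonneg hR.le,
    hn] at h1
  have h2 : δ ≤ ⟪x - z, N z⟫ := by
    have : R * δ ≤ R * ⟪x - z, N z⟫ := by nlinarith
    exact le_of_mul_le_mul_left this hR
  have h3 : ‖(x - z) - δ • N z‖ ^ 2 ≤ 0 := by
    rw [norm_sub_sq_real, inner_smul_right, norm_smul, h.norm_eq z hz,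
      Real.norm_of_nonneg hδ.le, hn]
    nlinarith
  have h4 : (x - z) - δ • N z = 0 := by
    rw [← norm_eq_zero]
    exact pow_eq_zero_iff two_ne_zero |>.1 (le_antisymm h3 (sq_nonneg _))
  rw [sub_eq_zero] at h4
  rw [← h4]; abel

/-- Both centres are at distance R from z and, the balls being disjoint, at least 2R apart, so they
are antipodal about z. -/
lemma UniformBallCondition.exists_hasTangentBalls {d : ℕ} {D : Set (E d)} {R : ℝ}
    (h : UniformBallCondition D R) : ∃ N : E d → E d, HasTangentBalls D R N := by
  obtain ⟨hR, h⟩ := h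
  have key : ∀ z ∈ frontier D, ∃ n : E d, ‖n‖ = 1 ∧ Metric.ball (z + R • n) R ⊆ D ∧
      Metric.ball (z - R • n) R ⊆ (closure D)ᶜ := by
    intro z hz
    obtain ⟨c₁, c₂, h1, h2, h3⟩ := h z hz
    have hz' : z ∈ frontier (Metric.ball c₁ R) ∩ frontier (Metric.ball c₂ R) := by rw [h3]; rfl
    rw [frontier_ball _ hR.ne', frontier_ball _ hR.ne'] at hz'
    have ha : ‖c₁ - z‖ = R := by
      rw [← dist_eq_norm, dist_comm]; exact hz'.1
    have hb : ‖c₂ - z‖ = R := by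
      rw [← dist_eq_norm, dist_comm]; exact hz'.2
    have hdis : Disjoint (Metric.ball c₁ R) (Metric.ball c₂ R) :=
      Set.disjoint_left.2 fun y hy hy' => h2 hy' (subset_closure (h1 hy))
    rw [disjoint_ball_ball_iff hR hR, dist_eq_norm] at hdis
    have h4 := parallelogram_law_with_norm ℝ (c₁ - z) (c₂ - z)
    rw [ha, hb, sub_sub_sub_cancel_right] at h4
    have h5 : (c₁ - z) + (c₂ - z) = 0 := by
      rw [← norm_eq_zero]
      nlinarith [norm_nonneg ((c₁ - z) + (c₂ - z)), norm_nonneg (c₁ - c₂)]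
    have e : R • (R⁻¹ • (c₁ - z)) = c₁ - z := smul_inv_smul₀ hR.ne' _
    refine ⟨R⁻¹ • (c₁ - z), ?_, ?_, ?_⟩
    · rw [norm_smul, ha, norm_inv, Real.norm_of_nonneg hR.le, inv_mul_cancel₀ hR.ne']
    · rw [e, add_sub_cancel]; exact h1
    · have : z - (c₁ - z) = c₂ := by
        rw [add_eq_zero_iff_eq_neg] at h5
        rw [h5]; abel
      rw [e, this]; exact h2
  choose! N hN using key
  exact ⟨N, fun z hz => (hN z hz).1, fun z hz => (hN z hz).2.1, fun z hz => (hN z hz).2.2⟩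

end Normals

/-! ### Volume of one-sided tubes -/

lemma euclideanHausdorffMeasure_image_le {X Y : Type*} [MetricSpace X] [MeasurableSpace X]
    [BorelSpace X] [MetricSpace Y] [MeasurableSpace Y] [BorelSpace Y] {K : ℝ≥0} {f : X → Y}
    {s : Set X} (h : LipschitzOnWith K f s) (k : ℕ) :
    Measure.euclideanHausdorffMeasure k (f '' s) ≤
      (K : ℝ≥0∞) ^ k * Measure.euclideanHausdorffMeasure k s := by
  have h1 := h.hausdorffMeasure_image_le (d := k) k.cast_nonneg
  rw [ENNReal.rpow_natCast] at h1
  simp only [Measure.euclideanHausdorffMeasure_def, Measure.smul_apply, ENNReal.smul_def,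
    smul_eq_mul]
  rw [mul_left_comm]
  gcongr

section Tube

open scoped RealInnerProductSpace
open Module

variable {V : Type*} [NormedAddCommGroup V] [InnerProductSpace ℝ V] [FiniteDimensional ℝ V]

/-- The orthogonal projection onto the hyperplane orthogonal to `n`. -/
noncomputable abbrev hyperProj (n : V) : V →L[ℝ] (ℝ ∙ n)ᗮ := (ℝ ∙ n)ᗮ.orthogonalProjectionOnto

lemma coe_orthogonalProjectionOnto_span {n : V} (hn : ‖n‖ = 1) (x : V) :
    ((ℝ ∙ n).orthogonalProjectionOnto x : V) = ⟪n, x⟫ • n :=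
  Submodule.starProjection_unit_singleton ℝ hn x

lemma norm_sq_eq_inner_sq_add {n : V} (hn : ‖n‖ = 1) (x : V) :
    ‖x‖ ^ 2 = ⟪n, x⟫ ^ 2 + ‖hyperProj n x‖ ^ 2 := by
  rw [Submodule.norm_sq_eq_add_norm_sq_projection x (ℝ ∙ n)]
  congr 1
  rw [Submodule.coe_norm, coe_orthogonalProjectionOnto_span hn, norm_smul, hn, mul_one,
    Real.norm_eq_abs, sq_abs]

/-- The base `B` is an arbitrary set, since it will be the projection of a possibly non-measurable
piece of boundary. -/
lemma volume_slab [MeasurableSpace V] [BorelSpace V] {n : V} (hn : ‖n‖ = 1)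
    (B : Set (ℝ ∙ n)ᗮ) (b : ℝ) :
    volume {x : V | hyperProj n x ∈ B ∧ ⟪n, x⟫ ∈ Set.Icc 0 b} =
      ENNReal.ofReal b * volume B := by
  set J : Set (ℝ ∙ n) := {y | ⟪n, (y : V)⟫ ∈ Set.Icc 0 b}
  have hJ : volume J = ENNReal.ofReal b := by
    have h := ((LinearIsometryEquiv.toSpanUnitSingleton (𝕜 := ℝ) n hn).measurePreserving
      |>.measure_preimage_emb
        (LinearIsometryEquiv.toSpanUnitSingleton (𝕜 := ℝ) n hn).toHomeomorph.measurableEmbedding J)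
    rw [← h]
    have : (LinearIsometryEquiv.toSpanUnitSingleton (𝕜 := ℝ) n hn) ⁻¹' J = Set.Icc 0 b := by
      ext r
      simp [J, inner_smul_right, hn]
    rw [this, Real.volume_Icc, sub_zero]
  have h := (Submodule.measurePreserving_measurableEquivProd (ℝ ∙ n) (0 : V)).measure_preimage_equiv
    (J ×ˢ B)
  rw [InnerProductSpace.euclideanHausdorffMeasure_eq_volume, Measure.volume_eq_prod,
    Measure.prod_prod, hJ] at h
  rw [← h]
  congr 1
  ext x
  simp [J, coe_orthogonalProjectionOnto_span hn, inner_smul_right, hn, and_comm]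

namespace IsNormalField

variable {F A : Set V} {R : ℝ} {N : V → V}

/-- The boundary is a nearly flat graph at scale R/100. The component of p - q along `N z` is at
most ‖p - q‖/50, half from tangency at q and half from the turning of the normal between q and z;
2500/2499 is 1/(1 - 50⁻²). -/
lemma norm_sub_sq_le (hN : IsNormalField F R N) (hR : 0 < R) {z : V} (hz : z ∈ F)
    {p q : V} (hp : p ∈ F) (hq : q ∈ F) (hpz : ‖p - z‖ ≤ R / 100) (hqz : ‖q - z‖ ≤ R / 100) :
    ‖p - q‖ ^ 2 ≤ 2500 / 2499 * ‖hyperProj (N z) (p - q)‖ ^ 2 := by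
  have h1 := hN.tangent q hq p hp
  have h2 := hN.lipschitz q hq z hz
  have hpq : ‖p - q‖ ≤ R / 50 := by
    have := norm_sub_le_norm_sub_add_norm_sub p z q
    rw [norm_sub_rev z q] at this
    linarith
  have h3 : ⟪N z, p - q⟫ = ⟪p - q, N q⟫ - ⟪p - q, N q - N z⟫ := by
    rw [inner_sub_right (p - q), sub_sub_cancel, real_inner_comm]
  have h4 : |⟪p - q, N q - N z⟫| ≤ ‖p - q‖ * ‖N q - N z‖ := abs_real_inner_le_norm _ _
  have h5 : |⟪N z, p - q⟫| ≤ ‖p - q‖ / 50 := by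
    have h6 : |⟪N z, p - q⟫| ≤ |⟪p - q, N q⟫| + |⟪p - q, N q - N z⟫| := by
      rw [h3]; exact abs_sub _ _
    have h7 : R * |⟪N z, p - q⟫| ≤ R * (‖p - q‖ / 50) := by
      nlinarith [norm_nonneg (p - q), norm_nonneg (N q - N z)]
    exact le_of_mul_le_mul_left h7 hR
  have h8 := norm_sq_eq_inner_sq_add (hN.norm_eq z hz) (p - q)
  have h9 : ⟪N z, p - q⟫ ^ 2 ≤ (‖p - q‖ / 50) ^ 2 :=
    sq_le_sq' (neg_le_of_abs_le h5) (le_of_abs_le h5)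
  linarith

/-- For s ≤ R/2 the turning of the normal stretches tangential lengths by at most 3/2, that is 9/4
after squaring, and the mixed term is small. The weights 3 and 4/3 leave room for it; the factor 4/9
becomes 1 when normal lengths are scaled by 2/3. -/
lemma norm_tube_sub_sq_le (hN : IsNormalField F R N) (hR : 0 < R) {z : V} (hz : z ∈ F)
    {p q : V} (hp : p ∈ F) (hq : q ∈ F) (hpz : ‖p - z‖ ≤ R / 100) (hqz : ‖q - z‖ ≤ R / 100)
    {s r : ℝ} (hs0 : 0 ≤ s) (hs : s ≤ R / 2) :
    ‖(p + s • N p) - (q + r • N q)‖ ^ 2 ≤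
      3 * (‖hyperProj (N z) (p - q)‖ ^ 2 + 4 / 9 * (s - r) ^ 2) := by
  have hproj := hN.norm_sub_sq_le hR hz hp hq hpz hqz
  have h1 := hN.tangent q hq p hp
  have h2 := hN.lipschitz p hp q hq
  have hpq : ‖p - q‖ ≤ R / 50 := by
    have := norm_sub_le_norm_sub_add_norm_sub p z q
    rw [norm_sub_rev z q] at this
    linarith
  set Δ := p - q with hΔ
  set ν := N p - N q with hν
  have hΔ0 := norm_nonneg Δ
  have hν0 := norm_nonneg ν
  have e : (p + s • N p) - (q + r • N q) = (Δ + s • ν) + (s - r) • N q := by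
    rw [hΔ, hν, smul_sub, sub_smul]; abel
  have h3 : ‖Δ + s • ν‖ ≤ 3 / 2 * ‖Δ‖ := by
    have := norm_add_le Δ (s • ν)
    rw [norm_smul, Real.norm_of_nonneg hs0] at this
    nlinarith
  have h4 : ⟪ν, N q⟫ = -‖ν‖ ^ 2 / 2 := by
    have hp1 := hN.norm_eq p hp
    have hq1 := hN.norm_eq q hq
    have h5 := norm_sub_sq_real (N p) (N q)
    rw [← hν, hp1, hq1] at h5
    rw [hν, inner_sub_left, real_inner_self_eq_norm_sq, hq1, ← hν]
    linarith
  have h5 : R * |⟪Δ + s • ν, N q⟫| ≤ 3 / 4 * ‖Δ‖ ^ 2 := by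
    have h6 : ⟪Δ + s • ν, N q⟫ = ⟪Δ, N q⟫ - s * ‖ν‖ ^ 2 / 2 := by
      rw [inner_add_left, real_inner_smul_left, h4]; ring
    have h7 : |⟪Δ + s • ν, N q⟫| ≤ |⟪Δ, N q⟫| + s * ‖ν‖ ^ 2 / 2 := by
      rw [h6]
      refine (abs_sub _ _).trans ?_
      rw [abs_of_nonneg (by positivity : 0 ≤ s * ‖ν‖ ^ 2 / 2)]
    have h8 : R * (s * ‖ν‖ ^ 2 / 2) ≤ ‖Δ‖ ^ 2 / 4 := by
      have h9 : (R * ‖ν‖) ^ 2 ≤ ‖Δ‖ ^ 2 := pow_le_pow_left₀ (by positivity) h2 2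
      have h10 : R * s * ‖ν‖ ^ 2 ≤ R * (R / 2) * ‖ν‖ ^ 2 := by gcongr
      nlinarith
    have := mul_le_mul_of_nonneg_left h7 hR.le
    linarith
  have h6 : |⟪Δ + s • ν, N q⟫| ≤ 3 / 200 * ‖Δ‖ := by
    have : R * |⟪Δ + s • ν, N q⟫| ≤ R * (3 / 200 * ‖Δ‖) := by nlinarith
    exact le_of_mul_le_mul_left this hR
  have h7 : ‖(Δ + s • ν) + (s - r) • N q‖ ^ 2 =
      ‖Δ + s • ν‖ ^ 2 + 2 * ((s - r) * ⟪Δ + s • ν, N q⟫) + (s - r) ^ 2 := by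
    rw [norm_add_sq_real, inner_smul_right, norm_smul, hN.norm_eq q hq, mul_one,
      Real.norm_eq_abs, sq_abs]
  have h8 : (s - r) * ⟪Δ + s • ν, N q⟫ ≤ |s - r| * (3 / 200 * ‖Δ‖) := by
    refine (le_abs_self _).trans ?_
    rw [abs_mul]
    gcongr
  have h9 : ‖Δ + s • ν‖ ^ 2 ≤ (3 / 2 * ‖Δ‖) ^ 2 := pow_le_pow_left₀ (norm_nonneg _) h3 2
  have h10 : 2 * (|s - r| * ‖Δ‖) ≤ (s - r) ^ 2 + ‖Δ‖ ^ 2 := by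
    have := sq_nonneg (|s - r| - ‖Δ‖)
    rw [sub_sq, sq_abs] at this
    linarith
  rw [e, h7]
  nlinarith [sq_nonneg (s - r)]

end IsNormalField

/-- The part of the tube of width `u` along the normals that is based at `A`. -/
def tube (N : V → V) (u : ℝ) (A : Set V) : Set V :=
  {x | ∃ p ∈ A, ∃ s ∈ Set.Icc 0 u, x = p + s • N p}

lemma tube_union (N : V → V) (u : ℝ) (A B : Set V) :
    tube N u (A ∪ B) = tube N u A ∪ tube N u B := by
  ext x
  simp only [tube, Set.mem_union, Set.mem_ofPred_eq, or_and_right, exists_or]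

variable [MeasurableSpace V] [BorelSpace V]

lemma IsNormalField.exists_leftInvOn {F : Set V} {R : ℝ} {N : V → V} (hN : IsNormalField F R N)
    (hR : 0 < R) {z : V} (hz : z ∈ F) {A : Set V} (hA : A ⊆ F ∩ Metric.closedBall z (R / 100)) :
    ∃ g : (ℝ ∙ N z)ᗮ → V, ∀ p ∈ A, g (hyperProj (N z) p) = p := by
  have hinj : Set.InjOn (hyperProj (N z)) A := fun p hp q hq hpq => by
    have h := hN.norm_sub_sq_le hR hz (hA hp).1 (hA hq).1
      (mem_closedBall_iff_norm.1 (hA hp).2) (mem_closedBall_iff_norm.1 (hA hq).2)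
    rw [map_sub, hpq, sub_self, norm_zero] at h
    rw [← sub_eq_zero, ← norm_eq_zero]
    exact pow_eq_zero_iff two_ne_zero |>.1 (le_antisymm (by simpa using h) (sq_nonneg _))
  exact ⟨Function.invFunOn (hyperProj (N z)) A, fun p hp => hinj.leftInvOn_invFunOn hp⟩

lemma volume_image_hyperProj_le {n : V} (hn : ‖n‖ = 1) (A : Set V) :
    volume (hyperProj n '' A) ≤
      Measure.euclideanHausdorffMeasure (finrank ℝ V - 1) A := by
  have hfin : finrank ℝ (ℝ ∙ n)ᗮ = finrank ℝ V - 1 := by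
    have h := Submodule.finrank_add_finrank_orthogonal (ℝ ∙ n)
    rw [finrank_span_singleton (fun h0 => by simp [h0] at hn)] at h
    omega
  rw [← InnerProductSpace.euclideanHausdorffMeasure_eq_volume, hfin]
  have h := euclideanHausdorffMeasure_image_le (K := 1)
    ((Submodule.lipschitzWith_orthogonalProjectionOnto (ℝ ∙ n)ᗮ).lipschitzOnWith (s := A))
    (finrank ℝ V - 1)
  simpa using h

lemma IsNormalField.euclideanHausdorffMeasure_lt_top {F : Set V} {R : ℝ} {N : V → V}
    (hN : IsNormalField F R N) (hR : 0 < R) {z : V} (hz : z ∈ F) {A : Set V}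
    (hA : A ⊆ F ∩ Metric.closedBall z (R / 100)) :
    Measure.euclideanHausdorffMeasure (finrank ℝ V - 1) A < ∞ := by
  have hn := hN.norm_eq z hz
  have hfin : finrank ℝ (ℝ ∙ N z)ᗮ = finrank ℝ V - 1 := by
    have h := Submodule.finrank_add_finrank_orthogonal (ℝ ∙ N z)
    rw [finrank_span_singleton (fun h0 => by simp [h0] at hn)] at h
    omega
  obtain ⟨g, hg⟩ := hN.exists_leftInvOn hR hz hA
  have hlip : LipschitzOnWith 2 g (hyperProj (N z) '' A) := by
    refine LipschitzOnWith.of_dist_le_mul ?_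
    rintro _ ⟨p, hp, rfl⟩ _ ⟨q, hq, rfl⟩
    rw [hg p hp, hg q hq, dist_eq_norm, dist_eq_norm, ← map_sub]
    have h := hN.norm_sub_sq_le hR hz (hA hp).1 (hA hq).1
      (mem_closedBall_iff_norm.1 (hA hp).2) (mem_closedBall_iff_norm.1 (hA hq).2)
    refine abs_le_of_sq_le_sq' ?_ (by positivity) |>.2
    rw [mul_pow]
    push_cast
    nlinarith [sq_nonneg ‖hyperProj (N z) (p - q)‖]
  have h1 := euclideanHausdorffMeasure_image_le hlip (finrank ℝ V - 1)
  have h2 : g '' (hyperProj (N z) '' A) = A := by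
    rw [Set.image_image]
    calc (fun p => g (hyperProj (N z) p)) '' A = id '' A := Set.image_congr fun p hp => hg p hp
      _ = A := Set.image_id A
  rw [h2, ← hfin, InnerProductSpace.euclideanHausdorffMeasure_eq_volume] at h1
  rw [← hfin]
  refine h1.trans_lt (ENNReal.mul_lt_top (by simp) ?_)
  have hb : Bornology.IsBounded (hyperProj (N z) '' A) :=
    (Submodule.lipschitzWith_orthogonalProjectionOnto (ℝ ∙ N z)ᗮ).isBounded_image
      (Metric.isBounded_closedBall.subset fun x hx => (hA hx).2)
  exact hb.measure_lt_top

lemma IsNormalField.volume_tube_le {F : Set V} {R : ℝ} {N : V → V}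
    (hN : IsNormalField F R N) (hR : 0 < R) {z : V} (hz : z ∈ F) {A : Set V}
    (hA : A ⊆ F ∩ Metric.closedBall z (R / 100)) {u : ℝ} (hu : u ≤ R / 2) :
    volume (tube N u A) ≤ (NNReal.sqrt 3 : ℝ≥0∞) ^ finrank ℝ V *
      (ENNReal.ofReal (2 / 3 * u) * Measure.euclideanHausdorffMeasure (finrank ℝ V - 1) A) := by
  obtain ⟨g, hg⟩ := hN.exists_leftInvOn hR hz hA
  have hn := hN.norm_eq z hz
  set T : Set V := {x | hyperProj (N z) x ∈ hyperProj (N z) '' A ∧ ⟪N z, x⟫ ∈ Set.Icc 0 (2 / 3 * u)}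
  -- The slab has height 2u/3, so the normal coordinate is stretched by 3/2; this makes tangential
  -- and normal stretching balance at √3.
  set Θ : V → V := fun x => g (hyperProj (N z) x) + (3 / 2 * ⟪N z, x⟫) • N (g (hyperProj (N z) x))
  have hlip : LipschitzOnWith (NNReal.sqrt 3) Θ T := by
    refine LipschitzOnWith.of_dist_le_mul ?_
    rintro x ⟨⟨p, hp, hpx⟩, hx0, hxu⟩ y ⟨⟨q, hq, hqy⟩, hy0, hyu⟩
    rw [dist_eq_norm, dist_eq_norm]
    simp only [Θ, ← hpx, ← hqy, hg p hp, hg q hq]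
    have h := hN.norm_tube_sub_sq_le hR hz (hA hp).1 (hA hq).1
      (mem_closedBall_iff_norm.1 (hA hp).2) (mem_closedBall_iff_norm.1 (hA hq).2)
      (s := 3 / 2 * ⟪N z, x⟫) (r := 3 / 2 * ⟪N z, y⟫) (by positivity) (by linarith)
    refine abs_le_of_sq_le_sq' (h.trans (le_of_eq ?_)) (by positivity) |>.2
    rw [mul_pow, norm_sq_eq_inner_sq_add hn (x - y), map_sub, map_sub, inner_sub_right, hpx, hqy]
    have : ((NNReal.sqrt 3 : ℝ≥0) : ℝ) ^ 2 = 3 := by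
      rw [← NNReal.coe_pow, NNReal.sq_sqrt]; rfl
    rw [this]
    ring
  have hsub : tube N u A ⊆ Θ '' T := by
    rintro x ⟨p, hp, s, ⟨hs0, hsu⟩, rfl⟩
    have h1 : hyperProj (N z) ((hyperProj (N z) p : V) + (2 / 3 * s) • N z) = hyperProj (N z) p := by
      rw [map_add, map_smul, Submodule.orthogonalProjectionOnto_mem_subspace_eq_self,
        Submodule.orthogonalProjectionOnto_orthogonal_apply_eq_zero
          (Submodule.mem_span_singleton_self (N z)), smul_zero, add_zero]
    have h2 : ⟪N z, (hyperProj (N z) p : V) + (2 / 3 * s) • N z⟫ = 2 / 3 * s := by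
      rw [inner_add_right, inner_smul_right, real_inner_self_eq_norm_sq, hn,
        Submodule.mem_orthogonal_singleton_iff_inner_right.1 (hyperProj (N z) p).2]
      ring
    refine ⟨(hyperProj (N z) p : V) + (2 / 3 * s) • N z, ⟨?_, ?_⟩, ?_⟩
    · rw [h1]; exact ⟨p, hp, rfl⟩
    · rw [h2]; exact ⟨by positivity, by linarith⟩
    · simp only [Θ, h1, h2, hg p hp]
      congr 2
      ring
  calc volume (tube N u A) ≤ volume (Θ '' T) := measure_mono hsub
    _ ≤ (NNReal.sqrt 3 : ℝ≥0∞) ^ finrank ℝ V * volume T := by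
        have := euclideanHausdorffMeasure_image_le hlip (finrank ℝ V)
        rwa [InnerProductSpace.euclideanHausdorffMeasure_eq_volume] at this
    _ ≤ _ := by
        gcongr
        rw [volume_slab hn]
        gcongr
        exact volume_image_hyperProj_le hn A

/-- Equality holds in the coefficients for d = 2, and each further dimension replaces √3 by 2. -/
lemma sqrt_three_pow_mul_le {d : ℕ} (hd : 2 ≤ d) (u : ℝ) :
    (NNReal.sqrt 3 : ℝ≥0∞) ^ d * ENNReal.ofReal (2 / 3 * u) ≤
      2 ^ (d - 1) * ENNReal.ofReal u := by
  obtain ⟨m, rfl⟩ := Nat.exists_eq_add_of_le hd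
  have h1 : NNReal.sqrt 3 ^ 2 = 3 := NNReal.sq_sqrt 3
  have h2 : NNReal.sqrt 3 ≤ 2 := by
    rw [NNReal.sqrt_le_iff_le_sq]; norm_num
  have h3 : ENNReal.ofReal (2 / 3 * u) = ((2 / 3 : ℝ≥0) : ℝ≥0∞) * ENNReal.ofReal u := by
    rw [ENNReal.ofReal_mul (by norm_num)]
    congr 1
    rw [ENNReal.ofReal]
    congr 1
    rw [← NNReal.coe_inj, Real.coe_toNNReal _ (by norm_num)]
    norm_num
  rw [h3, ← mul_assoc]
  gcongr
  have h4 : NNReal.sqrt 3 ^ (2 + m) * (2 / 3) ≤ 2 ^ (2 + m - 1) := by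
    have h5 : NNReal.sqrt 3 ^ m ≤ 2 ^ m := pow_le_pow_left₀ zero_le h2 m
    have h6 : 2 + m - 1 = m + 1 := by omega
    rw [pow_add, h1, h6, pow_succ]
    calc 3 * NNReal.sqrt 3 ^ m * (2 / 3) = NNReal.sqrt 3 ^ m * (3 * (2 / 3)) := by ring
      _ = NNReal.sqrt 3 ^ m * 2 := by norm_num
      _ ≤ _ := by gcongr
  exact_mod_cast h4

/-- The boundary has finite area, and a one-sided tube of width at most half of the radius of the
tangent balls has volume at most `2 ^ (d - 1)` times the width times the area. -/
lemma IsNormalField.volume_tube_le_of_isCompact {F : Set V} (hF : IsCompact F) {R : ℝ} {N : V → V}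
    (hN : IsNormalField F R N) (hR : 0 < R) (hd : 2 ≤ finrank ℝ V) :
    Measure.euclideanHausdorffMeasure (finrank ℝ V - 1) F < ∞ ∧ ∀ u ≤ R / 2,
      volume (tube N u F) ≤ 2 ^ (finrank ℝ V - 1) * ENNReal.ofReal u *
        Measure.euclideanHausdorffMeasure (finrank ℝ V - 1) F := by
  set H : Measure V := Measure.euclideanHausdorffMeasure (finrank ℝ V - 1)
  -- Asking for the bound on every subset B and for a measurable S lets patches be glued without
  -- overlap: B is cut along S, the area is additive on the two pieces, and the tube volume is
  -- subadditive.
  have key : ∃ S, MeasurableSet S ∧ F ⊆ S ∧ H (F ∩ S) < ∞ ∧ ∀ u ≤ R / 2, ∀ B ⊆ F ∩ S,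
      volume (tube N u B) ≤ 2 ^ (finrank ℝ V - 1) * ENNReal.ofReal u * H B := by
    refine hF.induction_on (p := fun s => ∃ S, MeasurableSet S ∧ s ⊆ S ∧ H (F ∩ S) < ∞ ∧
      ∀ u ≤ R / 2, ∀ B ⊆ F ∩ S,
        volume (tube N u B) ≤ 2 ^ (finrank ℝ V - 1) * ENNReal.ofReal u * H B) ?_ ?_ ?_ ?_
    · refine ⟨∅, MeasurableSet.empty, le_rfl, by simp, fun u _ B hB => ?_⟩
      have : tube N u B = ∅ := by
        rw [Set.inter_empty, Set.subset_empty_iff] at hB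
        simp [tube, hB]
      simp [this]
    · rintro s t hst ⟨S, h1, h2, h3⟩
      exact ⟨S, h1, hst.trans h2, h3⟩
    · rintro s t ⟨S, hS, hsS, hfS, hvS⟩ ⟨T, hT, htT, hfT, hvT⟩
      refine ⟨S ∪ T, hS.union hT, Set.union_subset_union hsS htT, ?_, fun u hu B hB => ?_⟩
      · rw [Set.inter_union_distrib_left]
        exact (measure_union_le _ _).trans_lt (ENNReal.add_lt_top.2 ⟨hfS, hfT⟩)
      · have h1 : B ∩ S ⊆ F ∩ S := fun x hx => ⟨(hB hx.1).1, hx.2⟩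
        have h2 : B \ S ⊆ F ∩ T := fun x hx => ⟨(hB hx.1).1, (hB hx.1).2.resolve_left hx.2⟩
        calc volume (tube N u B) = volume (tube N u (B ∩ S) ∪ tube N u (B \ S)) := by
              rw [← tube_union, Set.inter_union_sdiff]
          _ ≤ volume (tube N u (B ∩ S)) + volume (tube N u (B \ S)) := measure_union_le _ _
          _ ≤ _ := add_le_add (hvS u hu _ h1) (hvT u hu _ h2)
          _ = _ := by rw [← mul_add, measure_inter_add_sdiff B hS]
    · intro z hz
      refine ⟨Metric.closedBall z (R / 100),
        mem_nhdsWithin_of_mem_nhds (Metric.closedBall_mem_nhds z (by positivity)),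
        Metric.closedBall z (R / 100), measurableSet_closedBall, le_rfl,
        hN.euclideanHausdorffMeasure_lt_top hR hz le_rfl, fun u hu B hB => ?_⟩
      refine (hN.volume_tube_le hR hz hB hu).trans ?_
      rw [← mul_assoc]
      gcongr ?_ * _
      exact sqrt_three_pow_mul_le hd u
  obtain ⟨S, -, hFS, hfin, hvol⟩ := key
  rw [Set.inter_eq_left.2 hFS] at hfin hvol
  exact ⟨hfin, fun u hu => hvol u hu F le_rfl⟩

end Tube

/-! ### Ball radius from the boundary charts -/

section Charts

open scoped RealInnerProductSpace

lemma abs_sub_le_of_norm_gradient_le {V : Type*} [NormedAddCommGroup V] [InnerProductSpace ℝ V]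
    [CompleteSpace V] {φ : V → ℝ} (hφ : Differentiable ℝ φ) {L : ℝ}
    (hL : ∀ y, ‖gradient φ y‖ ≤ L * ‖y‖) (y : V) :
    |φ y - φ 0| ≤ L / 2 * ‖y‖ ^ 2 := by
  have hd : ∀ s : ℝ, HasDerivAt (fun s : ℝ => φ (s • y) - φ 0) ⟪gradient φ (s • y), y⟫ s := by
    intro s
    have h1 := (hφ (s • y)).hasGradientAt.hasFDerivAt
    have h2 : HasDerivAt (fun s : ℝ => s • y) y s := by
      simpa using (hasDerivAt_id s).smul_const y
    have h3 := h1.comp_hasDerivAt s h2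
    simpa using h3.sub_const (φ 0)
  have h := image_norm_le_of_norm_deriv_right_le_deriv_boundary
    (f := fun s : ℝ => φ (s • y) - φ 0) (f' := fun s => ⟪gradient φ (s • y), y⟫) (a := 0) (b := 1)
    (B := fun s => L / 2 * ‖y‖ ^ 2 * s ^ 2) (B' := fun s => L * ‖y‖ ^ 2 * s)
    (fun s _ => (hd s).continuousAt.continuousWithinAt)
    (fun s _ => (hd s).hasDerivWithinAt) (by simp)
    (fun s => ((hasDerivAt_pow 2 s).const_mul (L / 2 * ‖y‖ ^ 2)).congr_deriv (by
      norm_num; ring))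
    (fun s hs => by
      calc ‖⟪gradient φ (s • y), y⟫‖ ≤ ‖gradient φ (s • y)‖ * ‖y‖ := norm_inner_le_norm _ _
        _ ≤ L * ‖s • y‖ * ‖y‖ := by gcongr; exact hL _
        _ = L * ‖y‖ ^ 2 * s := by rw [norm_smul, Real.norm_of_nonneg hs.1]; ring)
    (x := 1) (by simp)
  simpa using h

lemma HasC11Characteristics.uniformBallCondition {d : ℕ} {D : Set (E d)} {R₀ L : ℝ}
    (h : HasC11Characteristics D R₀ L) : UniformBallCondition D (min (R₀ / 2) (1 / L)) := by
  have hR₀ := h.radius_pos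
  have hL := h.const_pos
  set R := min (R₀ / 2) (1 / L) with hRdef
  have hR : 0 < R := lt_min (by positivity) (by positivity)
  have hRR : 2 * R ≤ R₀ := by have := min_le_left (R₀ / 2) (1 / L); linarith
  have hRL : L * R ≤ 1 := by
    have := min_le_right (R₀ / 2) (1 / L)
    rwa [le_div_iff₀' hL] at this
  refine ⟨hR, fun z hz => ?_⟩
  obtain ⟨φ, e, hφ, hφ0, hg0, -, hgL, hD⟩ := h.chart z hz
  have hquad : ∀ y, |φ y| ≤ L / 2 * ‖y‖ ^ 2 := fun y => by
    have := abs_sub_le_of_norm_gradient_le (hφ.differentiable one_ne_zero) (L := L)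
      (fun y => by simpa [hg0] using hgL y 0) y
    rwa [hφ0, sub_zero] at this
  set v : E d := e.symm (WithLp.toLp 2 (0, 1)) with hv
  have hev : e v = WithLp.toLp 2 (0, 1) := e.apply_symm_apply _
  have hvn : ‖v‖ = 1 := by
    rw [hv, LinearIsometryEquiv.norm_map]
    simp
  have hsq : ∀ (x : E d) (r : ℝ), ‖(x - z) - r • v‖ ^ 2 =
      ‖(e (x - z)).fst‖ ^ 2 + ((e (x - z)).snd - r) ^ 2 := fun x r => by
    rw [← e.norm_map, map_sub, map_smul, hev, WithLp.prod_norm_sq_eq_of_L2]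
    simp
  -- This is where R ≤ 1/Λ enters: the graph stays between the two R-spheres tangent at z, since
  -- ‖y‖² + (s - R)² < R² gives Rs > ‖y‖²/2. The other constraint 2R ≤ R₀ keeps both balls inside
  -- the chart.
  have hquadR : ∀ y, R * |φ y| ≤ ‖y‖ ^ 2 / 2 := fun y => by
    have h1 := mul_le_mul_of_nonneg_left (hquad y) hR.le
    nlinarith [sq_nonneg ‖y‖]
  have hnear : ∀ (x : E d) (r : ℝ), |r| = R → ‖(x - z) - r • v‖ < R → x ∈ Metric.ball z R₀ := by
    intro x r hr hx
    rw [mem_ball_iff_norm]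
    have h1 : ‖x - z‖ ≤ ‖(x - z) - r • v‖ + ‖r • v‖ := norm_le_norm_sub_add _ _
    rw [norm_smul, hvn, Real.norm_eq_abs, hr] at h1
    linarith
  have hext : Disjoint (Metric.ball (z - R • v) R) D := by
    refine Set.disjoint_left.2 fun x hx hxD => ?_
    have e1 : x - (z - R • v) = (x - z) - (-R) • v := by rw [neg_smul]; abel
    rw [mem_ball_iff_norm, e1] at hx
    have hb := hnear x (-R) (by rw [abs_neg, abs_of_pos hR]) hx
    have hx' : x ∈ Metric.ball z R₀ ∩ {x | φ (e (x - z)).fst < (e (x - z)).snd} :=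
      hD ▸ ⟨hb, hxD⟩
    have h1 : φ (e (x - z)).fst < (e (x - z)).snd := hx'.2
    have h2 := pow_lt_pow_left₀ hx (norm_nonneg _) two_ne_zero
    rw [hsq] at h2
    have h3 := hquadR (e (x - z)).fst
    have h4 := neg_abs_le (φ (e (x - z)).fst)
    nlinarith [sq_nonneg (e (x - z)).snd]
  refine ⟨z + R • v, z - R • v, fun x hx => ?_, fun x hx hxD => ?_, ?_⟩
  · have e1 : x - (z + R • v) = (x - z) - R • v := by abel
    rw [mem_ball_iff_norm, e1] at hx
    have hb := hnear x R (abs_of_pos hR) hx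
    have h2 := pow_lt_pow_left₀ hx (norm_nonneg _) two_ne_zero
    rw [hsq] at h2
    have h3 := hquadR (e (x - z)).fst
    have h4 := le_abs_self (φ (e (x - z)).fst)
    have h5 : R * φ (e (x - z)).fst < R * (e (x - z)).snd := by
      nlinarith [sq_nonneg (e (x - z)).snd]
    have hx' : x ∈ Metric.ball z R₀ ∩ D := by
      rw [hD]
      exact ⟨hb, lt_of_mul_lt_mul_left h5 hR.le⟩
    exact hx'.2
  · exact Set.disjoint_left.1 (hext.closure_right Metric.isOpen_ball) hx hxD
  · rw [frontier_ball _ hR.ne', frontier_ball _ hR.ne']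
    ext x
    simp only [Set.mem_inter_iff, mem_sphere_iff_norm, Set.mem_singleton_iff]
    have e1 : x - (z + R • v) = (x - z) - R • v := by abel
    have e2 : x - (z - R • v) = (x - z) + R • v := by abel
    rw [e1, e2]
    constructor
    · rintro ⟨h1, h2⟩
      have h3 := parallelogram_law_with_norm ℝ (x - z) (R • v)
      rw [h1, h2, norm_smul, hvn, Real.norm_of_nonneg hR.le] at h3
      have h4 : ‖x - z‖ = 0 := by nlinarith [norm_nonneg (x - z)]
      rwa [norm_eq_zero, sub_eq_zero] at h4
    · rintro rfl
      simp [norm_smul, hvn, abs_of_pos hR]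

end Charts

/-! ### Boundary strips and exit times -/

section Domain

variable {d : ℕ} {D : Set (E d)}

lemma nonempty_frontier_of_isBounded (hd : 2 ≤ d) (hne : D.Nonempty)
    (hb : Bornology.IsBounded D) : (frontier D).Nonempty := by
  refine nonempty_frontier_iff.2 ⟨hne, fun h => ?_⟩
  have : Nonempty (Fin d) := ⟨⟨0, by omega⟩⟩
  rw [h] at hb
  exact NormedSpace.unbounded_univ ℝ (E d) hb

lemma isCompact_frontier_of_isBounded (hb : Bornology.IsBounded D) : IsCompact (frontier D) :=
  Metric.isCompact_of_isClosed_isBounded isClosed_frontier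
    (hb.closure.subset frontier_subset_closure)

/-- The inner tube of a domain with the uniform ball condition. -/
lemma volume_infDist_le (hd : 2 ≤ d) (hD : IsOpen D) (hb : Bornology.IsBounded D)
    (hne : D.Nonempty) {R : ℝ} (hR : UniformBallCondition D R) :
    Measure.euclideanHausdorffMeasure (d - 1) (frontier D) < ∞ ∧ ∀ u ≤ R / 2,
      volume {x ∈ D | Metric.infDist x (frontier D) ≤ u} ≤
        2 ^ (d - 1) * ENNReal.ofReal u *
          Measure.euclideanHausdorffMeasure (d - 1) (frontier D) := by
  obtain ⟨N, hN⟩ := hR.exists_hasTangentBalls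
  have h := (hN.isNormalField hD hR.1).volume_tube_le_of_isCompact
    (isCompact_frontier_of_isBounded hb) hR.1 (by simpa using hd)
  rw [finrank_euclideanSpace_fin] at h
  refine ⟨h.1, fun u hu => (measure_mono fun x hx => ?_).trans (h.2 u hu)⟩
  obtain ⟨z, hz, hxz⟩ := hN.exists_eq_add_smul hD hR.1
    (nonempty_frontier_of_isBounded hd hne hb) hx.1
  exact ⟨z, hz, _, ⟨Metric.infDist_nonneg, hx.2⟩, hxz⟩

/-- Right-continuity at t gives the strict inequality, because the path stays in the open set a
little longer. At t = 1 no exit time is left and the infimum is ∞. -/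
lemma lt_exitTime {F : Type*} [TopologicalSpace F] {D : Set F} (hD : IsOpen D)
    {f : unitInterval → F} {t : unitInterval} (hf : ContinuousWithinAt f (Set.Ici t) t)
    (h : ∀ s ≤ t, f s ∈ D) : ENNReal.ofReal (t : ℝ) < exitTime D f := by
  rcases (unitInterval.le_one' (t := t)).eq_or_lt with h1 | h1
  · have : {r : ℝ≥0∞ | ∃ s : unitInterval, 0 < s ∧ f s ∉ D ∧ r = ENNReal.ofReal (s : ℝ)} = ∅ := by
      ext r
      simp only [Set.mem_ofPred_eq, Set.mem_empty_iff_false, iff_false, not_exists, not_and]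
      intro s _ hs
      exact absurd (h s (h1 ▸ unitInterval.le_one')) hs
    rw [exitTime, this, sInf_empty]
    exact ENNReal.ofReal_lt_top
  · have h2 : f ⁻¹' D ∈ 𝓝[≥] t := hf (hD.mem_nhds (h t le_rfl))
    obtain ⟨u, hu, hsub⟩ := (mem_nhdsGE_iff_exists_Ico_subset' h1).1 h2
    have hu' : (t : ℝ) < u := hu
    refine lt_of_lt_of_le ((ENNReal.ofReal_lt_ofReal_iff (unitInterval.nonneg t |>.trans_lt hu')).2
      hu') (le_sInf ?_)
    rintro _ ⟨s, -, hs, rfl⟩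
    refine ENNReal.ofReal_le_ofReal ?_
    by_contra! hlt
    rcases le_or_gt s t with hst | hst
    · exact hs (h s hst)
    · exact hs (hsub ⟨hst.le, hlt⟩)

lemma exists_div_sqrt_le_abs {v : E d} {r : ℝ} (hr : 0 < r) (h : r ≤ ‖v‖) :
    ∃ i, r / √(d : ℝ) ≤ |v i| := by
  have hd : 0 < d := by
    rcases Nat.eq_zero_or_pos d with rfl | hd
    · have : v = 0 := Subsingleton.elim _ _
      rw [this, norm_zero] at h
      linarith
    · exact hd
  have hd' : (0 : ℝ) < d := by exact_mod_cast hd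
  have : Nonempty (Fin d) := ⟨⟨0, hd⟩⟩
  by_contra! hcon
  have h1 : ‖v‖ ^ 2 < r ^ 2 := by
    rw [EuclideanSpace.norm_sq_eq]
    calc ∑ i, ‖v i‖ ^ 2 < ∑ _i : Fin d, (r / √(d : ℝ)) ^ 2 := by
          refine Finset.sum_lt_sum_of_nonempty Finset.univ_nonempty fun i _ => ?_
          exact pow_lt_pow_left₀ (hcon i) (abs_nonneg _) two_ne_zero
      _ = r ^ 2 := by
          rw [Finset.sum_const, Finset.card_univ, Fintype.card_fin, nsmul_eq_mul, div_pow,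
            Real.sq_sqrt hd'.le]
          field_simp
  exact absurd (pow_le_pow_left₀ hr.le h 2) (not_le.2 h1)

end Domain

/-! ### The heat loss and its limit -/

section HeatContent

variable {Ω : Type*} [MeasurableSpace Ω] {P : Measure Ω} [IsProbabilityMeasure P]
variable {d : ℕ} {D : Set (E d)} {X : unitInterval → Ω → E d} {Y : unitInterval → Ω → ℝ}

/-- Every component of `X` and its reflection have right-continuous paths and the law of `Y`. -/
structure SameLawComponents (X : unitInterval → Ω → E d) (Y : unitInterval → Ω → ℝ)
    (P : Measure Ω) : Prop where
  rightCts : ∀ ω t, ContinuousWithinAt (fun s => X s ω) (Set.Ici t) t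
  pos : ∀ i, IdentDistrib (fun ω s => component X i s ω) (fun ω s => Y s ω) P P
  neg : ∀ i, IdentDistrib (fun ω s => -component X i s ω) (fun ω s => Y s ω) P P

/-- Written as a covering of the whole space, the estimate needs only subadditivity, so the exit
event need not be shown measurable. -/
lemma SameLawComponents.one_le (hX : SameLawComponents X Y P) (hY : RegularGaussian Y P)
    (hD : IsOpen D) (hne : (frontier D).Nonempty) {t : unitInterval} (ht : 0 < t) {x : E d}
    (hx : x ∈ D) :
    1 ≤ P {ω | ENNReal.ofReal (t : ℝ) < exitTime D (fun s => x + X s ω)} +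
      2 * d * P {ω | Metric.infDist x (frontier D) / √(d : ℝ) ≤ runningSup Y t ω} := by
  set δ := Metric.infDist x (frontier D)
  have hδ : 0 < δ := (isClosed_frontier.notMem_iff_infDist_pos hne).1 fun h => by
    rw [hD.frontier_eq] at h; exact h.2 hx
  set p := P {ω | δ / √(d : ℝ) ≤ runningSup Y t ω}
  have hrc : ∀ i ω, RightCts fun s => component X i s ω := fun i ω s =>
    ((EuclideanSpace.proj i : E d →L[ℝ] ℝ).continuous.continuousAt.comp_continuousWithinAt
      (hX.rightCts ω s))
  have hsub : Set.univ ⊆ {ω | ENNReal.ofReal (t : ℝ) < exitTime D (fun s => x + X s ω)} ∪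
      ⋃ i : Fin d, ({ω | ∃ s ≤ t, δ / √(d : ℝ) ≤ component X i s ω} ∪
        {ω | ∃ s ≤ t, δ / √(d : ℝ) ≤ -component X i s ω}) := by
    intro ω _
    by_cases h : ∀ s ≤ t, ‖X s ω‖ < δ
    · refine Or.inl (lt_exitTime hD ?_ fun s hs => ?_)
      · exact continuousWithinAt_const.add (hX.rightCts ω t)
      · refine ball_infDist_frontier_subset hD hx ?_
        rw [mem_ball_iff_norm, add_sub_cancel_left]
        exact h s hs
    · push Not at h
      obtain ⟨s, hs, hn⟩ := h
      obtain ⟨i, hi⟩ := exists_div_sqrt_le_abs hδ hn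
      refine Or.inr (Set.mem_iUnion.2 ⟨i, ?_⟩)
      rcases le_abs.1 hi with h1 | h1
      · exact Or.inl ⟨s, hs, h1⟩
      · exact Or.inr ⟨s, hs, h1⟩
  calc (1 : ℝ≥0∞) = P Set.univ := measure_univ.symm
    _ ≤ _ := measure_mono hsub
    _ ≤ _ := measure_union_le _ _
    _ ≤ _ := by
        gcongr
        calc _ ≤ ∑ i : Fin d, P ({ω | ∃ s ≤ t, δ / √(d : ℝ) ≤ component X i s ω} ∪
              {ω | ∃ s ≤ t, δ / √(d : ℝ) ≤ -component X i s ω}) := measure_iUnion_fintype_le _ _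
          _ ≤ ∑ _i : Fin d, (p + p) := by
              refine Finset.sum_le_sum fun i _ => (measure_union_le _ _).trans ?_
              refine add_le_add (hY.measure_exists_ge_le (hrc i) (hX.pos i) ht _) ?_
              exact hY.measure_exists_ge_le (Z := fun s ω => -component X i s ω)
                (fun ω s => (hrc i ω s).neg) (hX.neg i) ht _
          _ = 2 * d * p := by simp; ring

lemma measurable_measure_infDist_le (Y : unitInterval → Ω → ℝ) (t : unitInterval)
    (F : Set (E d)) :
    Measurable fun x : E d => P {ω | Metric.infDist x F / √(d : ℝ) ≤ runningSup Y t ω} := by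
  have h : Antitone fun r : ℝ => P {ω | r ≤ runningSup Y t ω} := fun r s hrs =>
    measure_mono fun ω hω => hrs.trans hω
  exact h.measurable.comp ((Metric.continuous_infDist_pt F).div_const _).measurable

lemma measurableSet_innerPart (hD : IsOpen D) (a : ℝ) : MeasurableSet (innerPart D a) :=
  hD.measurableSet.inter
    (measurableSet_lt measurable_const (Metric.continuous_infDist_pt (frontier D)).measurable)

lemma lintegral_boundary_le (hd : 2 ≤ d) (hD : IsOpen D) (hb : Bornology.IsBounded D)
    (hne : D.Nonempty) {R : ℝ} (hR : UniformBallCondition D R) (hY : RegularGaussian Y P)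
    {t : unitInterval} (ht : 0 < t) {a : ℝ} (ha : a ≤ R / 2) :
    ∫⁻ x in D \ innerPart D a,
        P {ω | Metric.infDist x (frontier D) / √(d : ℝ) ≤ runningSup Y t ω} ≤
      2 ^ (d - 1) * Measure.euclideanHausdorffMeasure (d - 1) (frontier D) *
        ENNReal.ofReal (√(d : ℝ) * expectedSup Y P t) := by
  have hd0 : (0 : ℝ) < √(d : ℝ) := Real.sqrt_pos.2 (by exact_mod_cast (by omega : 0 < d))
  obtain ⟨-, htube⟩ := volume_infDist_le hd hD hb hne hR
  set ν := (volume : Measure (E d)).restrict (D \ innerPart D a)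
  set s : Set (E d × Ω) :=
    {q | Metric.infDist q.1 (frontier D) / √(d : ℝ) ≤ runningSup Y t q.2}
  have hmeas : MeasurableSet (D \ innerPart D a) :=
    hD.measurableSet.diff (measurableSet_innerPart hD a)
  have hs : MeasurableSet s := by
    refine measurableSet_le ?_ ((hY.measurable_runningSup t).comp measurable_snd)
    exact (((Metric.continuous_infDist_pt (frontier D)).div_const _).measurable).comp
      measurable_fst
  calc _ = (ν.prod P) s := (Measure.prod_apply hs).symm
    _ = ∫⁻ ω, ν ((fun x => (x, ω)) ⁻¹' s) ∂P := Measure.prod_apply_symm hs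
    _ ≤ ∫⁻ ω, 2 ^ (d - 1) * Measure.euclideanHausdorffMeasure (d - 1) (frontier D) *
          ENNReal.ofReal (√(d : ℝ) * runningSup Y t ω) ∂P := by
        refine lintegral_mono fun ω => ?_
        -- The tube bound holds only for widths up to R/2; truncating at `a` respects this and is
        -- dropped afterwards.
        set u := min a (√(d : ℝ) * runningSup Y t ω)
        calc ν ((fun x => (x, ω)) ⁻¹' s)
            ≤ volume {x ∈ D | Metric.infDist x (frontier D) ≤ u} := by
              rw [Measure.restrict_apply' hmeas]
              refine measure_mono ?_
              rintro x ⟨hx1, hxD, hx2⟩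
              refine ⟨hxD, le_min ?_ ?_⟩
              · by_contra! hlt
                exact hx2 ⟨hxD, hlt⟩
              · have h1 : Metric.infDist x (frontier D) / √(d : ℝ) ≤ runningSup Y t ω := hx1
                rwa [div_le_iff₀' hd0] at h1
          _ ≤ _ := htube u ((min_le_left _ _).trans ha)
          _ ≤ _ := by
              rw [mul_right_comm]
              gcongr
              exact min_le_right _ _
    _ = _ := by
        rw [lintegral_const_mul _ ((hY.measurable_runningSup t).const_mul _).ennreal_ofReal,
          ← ofReal_integral_eq_lintegral_ofReal ((hY.integrable_runningSup ht).const_mul _)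
            (ae_of_all _ fun ω => mul_nonneg hd0.le (hY.runningSup_nonneg t ω)),
          integral_const_mul]
        rfl

lemma lintegral_innerPart_le (hD : IsOpen D) (hY : RegularGaussian Y P)
    {t : unitInterval} (ht : 0 < t) {a : ℝ} (hμ : expectedSup Y P t < a / √(d : ℝ)) :
    ∫⁻ x in innerPart D a,
        P {ω | Metric.infDist x (frontier D) / √(d : ℝ) ≤ runningSup Y t ω} ≤
      ENNReal.ofReal (Real.exp (-(a / √(d : ℝ) - expectedSup Y P t) ^ 2 /
        (2 * supVariance Y P t))) * volume (innerPart D a) := by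
  rw [← setLIntegral_const]
  refine setLIntegral_mono' (measurableSet_innerPart hD a) fun x hx => ?_
  refine le_trans (measure_mono fun ω hω => ?_) (hY.measure_runningSup_ge_le ht hμ)
  show a / √(d : ℝ) ≤ runningSup Y t ω
  have hω' : Metric.infDist x (frontier D) / √(d : ℝ) ≤ runningSup Y t ω := hω
  have := hx.2.le
  exact le_trans (by gcongr) hω'

lemma rpow_three_halves (d : ℕ) : (d : ℝ) ^ (3 / 2 : ℝ) = d * √(d : ℝ) := by
  rcases Nat.eq_zero_or_pos d with rfl | hd
  · simp
  · have : (3 / 2 : ℝ) = 1 + 1 / 2 := by norm_num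
    rw [this, Real.rpow_add (by exact_mod_cast hd), Real.rpow_one, Real.sqrt_eq_rpow]

lemma vol_sub_spectralHeatContent_le (hd : 2 ≤ d) (hD : IsOpen D)
    (hb : Bornology.IsBounded D) (hne : D.Nonempty) (hX : SameLawComponents X Y P)
    (hY : RegularGaussian Y P) {R : ℝ} (hR : UniformBallCondition D R)
    {t : unitInterval} (ht : 0 < t) {a : ℝ} (ha : a ≤ R / 2)
    (hμ : expectedSup Y P t < a / √(d : ℝ)) :
    vol D - spectralHeatContent X P D t ≤
      (d : ℝ) ^ (3 / 2 : ℝ) * 2 ^ d * perimeter D * expectedSup Y P t +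
        4 * (d : ℝ) * vol (innerPart D a) *
          Real.exp (-(a / √(d : ℝ) - expectedSup Y P t) ^ 2 / (2 * supVariance Y P t)) := by
  set μ := expectedSup Y P t with hμdef
  set ε := Real.exp (-(a / √(d : ℝ) - μ) ^ 2 / (2 * supVariance Y P t))
  set G : E d → ℝ≥0∞ := fun x =>
    P {ω | Metric.infDist x (frontier D) / √(d : ℝ) ≤ runningSup Y t ω}
  set q : E d → ℝ≥0∞ := fun x =>
    P {ω | ENNReal.ofReal (t : ℝ) < exitTime D (fun s => x + X s ω)}
  set H := Measure.euclideanHausdorffMeasure (d - 1) (frontier D)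
  have hfr := nonempty_frontier_of_isBounded hd hne hb
  have hμ0 : 0 < μ := hY.expectedSup_pos ht
  have hH : H ≠ ∞ := (volume_infDist_le hd hD hb hne hR).1.ne
  have hvD : volume D ≠ ∞ := hb.measure_lt_top.ne
  have hsubset : innerPart D a ⊆ D := fun x hx => hx.1
  have hvI : volume (innerPart D a) ≠ ∞ := ((measure_mono hsubset).trans_lt hvD.lt_top).ne
  have hGm : Measurable G := measurable_measure_infDist_le Y t (frontier D)
  have hsplit : ∫⁻ x in D, G x ≤
      2 ^ (d - 1) * H * ENNReal.ofReal (√(d : ℝ) * μ) +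
        ENNReal.ofReal ε * volume (innerPart D a) := by
    rw [← Set.sdiff_union_of_subset hsubset]
    exact (lintegral_union_le _ _ _).trans (add_le_add
      (by simpa only [Set.sdiff_union_of_subset hsubset] using
        lintegral_boundary_le hd hD hb hne hR hY ht ha)
      (by simpa only [Set.sdiff_union_of_subset hsubset] using
        lintegral_innerPart_le hD hY ht hμ))
  have hQ : ∫⁻ x in D, q x ≠ ∞ := by
    refine ((setLIntegral_mono' (g := fun _ => 1) hD.measurableSet
      fun x _ => prob_le_one).trans_lt ?_).ne
    rw [setLIntegral_const, one_mul]
    exact hvD.lt_top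
  have hmain : volume D ≤ ∫⁻ x in D, q x + 2 * d * G x := by
    calc volume D = ∫⁻ x in D, 1 := by rw [setLIntegral_const, one_mul]
      _ ≤ _ := setLIntegral_mono' hD.measurableSet fun x hx => hX.one_le hY hD hfr ht hx
  rw [lintegral_add_right _ (hGm.const_mul _), lintegral_const_mul _ hGm] at hmain
  have hle : volume D ≤ (∫⁻ x in D, q x) + 2 * d * (2 ^ (d - 1) * H *
      ENNReal.ofReal (√(d : ℝ) * μ) + ENNReal.ofReal ε * volume (innerPart D a)) :=
    hmain.trans (by gcongr)
  have hA : 2 ^ (d - 1) * H * ENNReal.ofReal (√(d : ℝ) * μ) ≠ ∞ :=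
    ENNReal.mul_ne_top (ENNReal.mul_ne_top (by simp) hH) ENNReal.ofReal_ne_top
  have hB : ENNReal.ofReal ε * volume (innerPart D a) ≠ ∞ :=
    ENNReal.mul_ne_top ENNReal.ofReal_ne_top hvI
  have hC : 2 * (d : ℝ≥0∞) * (2 ^ (d - 1) * H * ENNReal.ofReal (√(d : ℝ) * μ) +
      ENNReal.ofReal ε * volume (innerPart D a)) ≠ ∞ :=
    ENNReal.mul_ne_top (ENNReal.mul_ne_top (by simp) (ENNReal.natCast_ne_top d))
      (ENNReal.add_ne_top.2 ⟨hA, hB⟩)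
  have hreal := ENNReal.toReal_mono (ENNReal.add_ne_top.2 ⟨hQ, hC⟩) hle
  rw [ENNReal.toReal_add hQ hC, ENNReal.toReal_mul, ENNReal.toReal_add hA hB,
    ENNReal.toReal_mul, ENNReal.toReal_mul, ENNReal.toReal_mul, ENNReal.toReal_mul,
    ENNReal.toReal_ofReal (by positivity), ENNReal.toReal_ofReal (Real.exp_pos _).le,
    ENNReal.toReal_pow] at hreal
  simp only [ENNReal.toReal_ofNat, ENNReal.toReal_natCast] at hreal
  have hvol : vol D = (volume D).toReal := rfl
  have hvolI : vol (innerPart D a) = (volume (innerPart D a)).toReal := rfl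
  have hper : perimeter D = H.toReal := rfl
  have hheat : spectralHeatContent X P D t = (∫⁻ x in D, q x).toReal := rfl
  rw [hvol, hvolI, hper, hheat, rpow_three_halves]
  have h2 : (2 : ℝ) ^ d = 2 ^ (d - 1) * 2 := by
    rw [← pow_succ]; congr 1; omega
  rw [h2]
  -- The argument yields 2d in front of the exponential; adding this nonnegative term gives the
  -- stated 4d.
  have hpos : 0 ≤ 2 * (d : ℝ) * (ε * (volume (innerPart D a)).toReal) := by positivity
  linarith

lemma tendsto_upper_bound (C K κ : ℝ) :
    Tendsto (fun μ : ℝ => C + K * (μ / κ)) (𝓝 0) (𝓝 C) := by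
  have : Continuous fun μ : ℝ => C + K * (μ / κ) := by fun_prop
  simpa using this.tendsto 0

/-- With σ ≤ μ²/c² and b - μ ≥ b/2 the exponent is at least (c²b²/8)/μ², and exp(-v) ≤ 1/v makes the
exponential term O(μ²). -/
lemma exp_neg_div_le {b c μ σ : ℝ} (hc : 0 < c) (hμ0 : 0 < μ) (hμ : μ < b / 2) (hσ : 0 < σ)
    (hσμ : c ^ 2 * σ ≤ μ ^ 2) :
    Real.exp (-(b - μ) ^ 2 / (2 * σ)) ≤ μ * (μ / (c ^ 2 * b ^ 2 / 8)) := by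
  have hb : 0 < b := by linarith
  set κ := c ^ 2 * b ^ 2 / 8 with hκdef
  have hκ : 0 < κ := by positivity
  have h1 : κ / μ ^ 2 ≤ (b - μ) ^ 2 / (2 * σ) := by
    rw [div_le_div_iff₀ (by positivity) (by positivity)]
    have h2 : (b / 2) ^ 2 ≤ (b - μ) ^ 2 := pow_le_pow_left₀ (by positivity) (by linarith) 2
    calc κ * (2 * σ) = (b / 2) ^ 2 * (c ^ 2 * σ) := by rw [hκdef]; ring
      _ ≤ (b - μ) ^ 2 * μ ^ 2 := by gcongr
  have h3 : κ / μ ^ 2 ≤ Real.exp ((b - μ) ^ 2 / (2 * σ)) := by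
    have := Real.add_one_le_exp ((b - μ) ^ 2 / (2 * σ))
    linarith
  rw [neg_div, Real.exp_neg, show μ * (μ / κ) = (κ / μ ^ 2)⁻¹ by field_simp]
  exact inv_anti₀ (by positivity) h3

lemma limsup_heat_loss_le (hd : 2 ≤ d) (hD : IsOpen D)
    (hb : Bornology.IsBounded D) (hne : D.Nonempty) (hX : SameLawComponents X Y P)
    (hY : RegularGaussian Y P) {R : ℝ} (hR : UniformBallCondition D R) :
    limsup (fun t : unitInterval =>
        (((vol D - spectralHeatContent X P D t) / expectedSup Y P t : ℝ) : EReal))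
      (𝓝[>] (0 : unitInterval)) ≤
      (((d : ℝ) ^ (3 / 2 : ℝ) * 2 ^ d * perimeter D : ℝ) : EReal) := by
  have hR0 := hR.1
  have hd0 : (0 : ℝ) < √(d : ℝ) := Real.sqrt_pos.2 (by exact_mod_cast (by omega : 0 < d))
  set C := (d : ℝ) ^ (3 / 2 : ℝ) * 2 ^ d * perimeter D
  set a := R / 2
  set b := a / √(d : ℝ) with hbdef
  have hb0 : 0 < b := by positivity
  set c := gaussianTail.toReal
  have hc : 0 < c := ENNReal.toReal_pos gaussianTail_pos.ne' gaussianTail_ne_top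
  set K := 4 * (d : ℝ) * vol (innerPart D a)
  have hK : 0 ≤ K := mul_nonneg (by positivity) ENNReal.toReal_nonneg
  have hμlim := hY.tendsto_expectedSup
  have hev : ∀ᶠ t in 𝓝[>] (0 : unitInterval),
      (((vol D - spectralHeatContent X P D t) / expectedSup Y P t : ℝ) : EReal) ≤
        ((C + K * (expectedSup Y P t / (c ^ 2 * b ^ 2 / 8)) : ℝ) : EReal) := by
    filter_upwards [self_mem_nhdsWithin, hμlim.eventually_lt_const (half_pos hb0)] with t ht hμ
    have hμ0 : 0 < expectedSup Y P t := hY.expectedSup_pos ht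
    have h1 := vol_sub_spectralHeatContent_le hd hD hb hne hX hY hR ht le_rfl
      (hμ.trans (half_lt_self hb0))
    have h2 := exp_neg_div_le hc hμ0 hμ (hY.supVariance_pos ht)
      (hY.sq_tail_mul_supVariance_le ht)
    rw [EReal.coe_le_coe_iff, div_le_iff₀ hμ0]
    refine h1.trans ?_
    have h3 := mul_le_mul_of_nonneg_left h2 hK
    calc _ ≤ C * expectedSup Y P t +
          K * (expectedSup Y P t * (expectedSup Y P t / (c ^ 2 * b ^ 2 / 8))) := by gcongr
      _ = _ := by ring
  have hlim : Tendsto (fun t => ((C + K * (expectedSup Y P t / (c ^ 2 * b ^ 2 / 8)) : ℝ) : EReal))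
      (𝓝[>] (0 : unitInterval)) (𝓝 (C : EReal)) :=
    (continuous_coe_real_ereal.tendsto _).comp ((tendsto_upper_bound C K _).comp hμlim)
  have hbot : (𝓝[>] (0 : unitInterval)).NeBot := nhdsGT_neBot_of_exists_gt ⟨1, zero_lt_one⟩
  exact (limsup_le_limsup hev).trans hlim.limsup_eq.le

end HeatContent
end GaussianHeat

theorem mainTheorem4 {d : ℕ} (hd : 2 ≤ d)
    (D : Set (GaussianHeat.E d)) (hDconn : IsConnected D) (hDbdd : Bornology.IsBounded D)
    (R₀ Λ : ℝ) (hD : GaussianHeat.HasC11Characteristics D R₀ Λ)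
    {Ω : Type*} [MeasurableSpace Ω] (P : Measure Ω) [IsProbabilityMeasure P]
    (X : unitInterval → Ω → GaussianHeat.E d)
    (hXmeas : ∀ s, Measurable (X s))
    (hXcadlag : ∀ ω, GaussianHeat.IsCadlag (fun s => X s ω))
    (hXzero : ∀ ω, X 0 ω = 0)
    (hXgauss : ∀ j : Fin d,
      GaussianHeat.IsAdmissibleGaussian (GaussianHeat.component X j) P)
    (hXident : ∀ i j : Fin d,
      IdentDistrib (fun ω s => GaussianHeat.component X i s ω)
        (fun ω s => GaussianHeat.component X j s ω) P P) :
    GaussianHeat.UniformBallCondition D (min (R₀ / 2) (1 / Λ)) ∧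
    (∀ R : ℝ, GaussianHeat.UniformBallCondition D R →
      ∀ (j : Fin d) (t : unitInterval) (a : ℝ), 0 < t → 0 < a → a ≤ R / 2 →
        GaussianHeat.expectedSup (GaussianHeat.component X j) P t < a / √(d : ℝ) →
        GaussianHeat.vol D - GaussianHeat.spectralHeatContent X P D t ≤
          (d : ℝ) ^ (3 / 2 : ℝ) * 2 ^ d * GaussianHeat.perimeter D *
              GaussianHeat.expectedSup (GaussianHeat.component X j) P t +
            4 * (d : ℝ) * GaussianHeat.vol (GaussianHeat.innerPart D a) *
              Real.exp (-(a / √(d : ℝ) -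
                  GaussianHeat.expectedSup (GaussianHeat.component X j) P t) ^ 2 /
                (2 * GaussianHeat.supVariance (GaussianHeat.component X j) P t))) ∧
    (∀ j : Fin d,
      limsup (fun t : unitInterval =>
          (((GaussianHeat.vol D - GaussianHeat.spectralHeatContent X P D t) /
            GaussianHeat.expectedSup (GaussianHeat.component X j) P t : ℝ) : EReal))
        (𝓝[>] (0 : unitInterval)) ≤
      (((d : ℝ) ^ (3 / 2 : ℝ) * 2 ^ d * GaussianHeat.perimeter D : ℝ) : EReal)) := by
  have hY : ∀ j, GaussianHeat.RegularGaussian (GaussianHeat.component X j) P := fun j =>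
    { admissible := hXgauss j
      measurable := fun s => (EuclideanSpace.proj j : GaussianHeat.E d →L[ℝ] ℝ).measurable.comp
        (hXmeas s)
      rightCts := fun ω s => (EuclideanSpace.proj j : GaussianHeat.E d →L[ℝ] ℝ).continuous
        |>.continuousAt.comp_continuousWithinAt (hXcadlag ω s).1
      zero := fun ω => by simp [GaussianHeat.component, hXzero ω] }
  have hX : ∀ j, GaussianHeat.SameLawComponents X (GaussianHeat.component X j) P := fun j =>
    { rightCts := fun ω s => (hXcadlag ω s).1
      pos := fun i => hXident i j
      -- Any component may serve as reference; reflections come from Gaussian symmetry.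
      neg := fun i => (hY i).identDistrib_neg.trans (hXident i j) }
  have hball := hD.uniformBallCondition
  exact ⟨hball,
    fun R hR j t a ht _ ha hμ => GaussianHeat.vol_sub_spectralHeatContent_le hd hD.isOpen hDbdd
      hDconn.nonempty (hX j) (hY j) hR ht ha hμ,
    fun j => GaussianHeat.limsup_heat_loss_le hd hD.isOpen hDbdd hDconn.nonempty (hX j) (hY j)
      hball⟩
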